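/- **Setting.** Let $T>0$, let $(\Omega,\mathcal F,\mathbb P)$ be a complete probability space carrying a standard one-dimensional Brownian motion $(W_t)_{0\le t\le T}$, and let $\mathcal F_T=\sigma(W_s,\,0\le s\le T)$ augmented by the $\mathbb P$-null sets. Let $r,\mu,\sigma>0$ with $\mu\ne r$, put $\theta=(\mu-r)/\sigma$, and let $\xi_T=\exp\!\big(-(r+\tfrac{\theta^2}{2})T-\theta W_T\big)$ be the terminal value of the state price density $d\xi_t/\xi_t=-r\,dt-\theta\,dW_t$, $\xi_0=1$; $F_\xi$ is its distribution function and $x>0$ is the initial endowment. For a random variable $Y$ with values in $[-\infty,\infty)$ and distribution function $F_Y$, let $G_Y(z)=\inf\{y\in\mathbb R: F_Y(y)>z\}$ for $z\in[0,1)$ and $G_Y(1)=\lim_{z\uparrow1}G_Y(z)$. For a probability measure $\Phi$ on $[0,1]$ let $\rho_\Phi(Y)=-\int_{[0,1]}G_Y(z)\,\Phi(dz)$. Expectations and integrals of extended real functions are integrals of the positive part minus integrals of the negative part, expressions $\infty-\infty$ are counted as $-\infty$ (in expectations, in $\int G_Y\,d\Phi$, and in the objective below), $\ln0=-\infty$,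 and $0\cdot(-\infty)=0$. Assume $\Phi(\{1\})=0$ and that $\Phi$ is not the uniform measure on $[0,1]$. A terminal wealth $X_T$ is feasible if it is a real-valued $\mathcal F_T$-measurable random variable with $X_T\ge0$ a.s. and $\mathbb E[\xi_TX_T]\le x$; its log-return is $R_T=\frac1T\ln\frac{X_T}{x}$. For $0\le\lambda<\infty$, the static mean-WVaR problem is to maximize $\lambda\,\mathbb E[R_T]-\rho_\Phi(R_T)$ over all feasible $X_T$. The min-risk problem is to minimize $\rho_\Phi(R_T)$ over all feasible $X_T$. Let $$w(s)=\frac{1}{\mathbb E[\xi_T]}\int_{[0,s)}G_{\xi_T}(1-z)\,dz,\quad s\in[0,1],$$ which is a bijection of $[0,1]$ with inverse $w^{-1}$, let $$\varphi(s-;\lambda)=\frac{\Phi\big([0,w^{-1}(s))\big)+\lambda\,w^{-1}(s)}{1+\lambda},\quad s\in[0,1],$$ let $\delta(\cdot;\lambda)$ be the convex envelope of $\varphi(\cdot-;\lambda)$ on $[0,1]$, i.e. the largest convex function on $[0,1]$ dominated by it, and let $\delta'(\cdot;\lambda)$ be the right derivative of $\delta(\cdot;\lambda)$. **Proposition (Efficient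 portfolio).** For every $0\le\lambda<\infty$, the static mean-WVaR problem has the optimal solution $$X^*_{T,\lambda}=\frac{x}{\mathbb E[\xi_T]}\,\delta'\big(w(1-F_\xi(\xi_T));\lambda\big),$$ which is the only one, up to $\mathbb P$-null sets, whenever the optimal value is finite. The corresponding log-return is $$R^*_{T,\lambda}=\frac1T\ln\!\left(\frac{\delta'\big(w(1-F_\xi(\xi_T));\lambda\big)}{\mathbb E[\xi_T]}\right).$$ In particular, the min-risk problem has the optimal solution $$X^*_{T,0}=\frac{x}{\mathbb E[\xi_T]}\,\delta'\big(w(1-F_\xi(\xi_T));0\big),$$ which is the only one, up to $\mathbb P$-null sets, whenever the minimal risk is finite, and its log-return is $$R^*_{T,0}=\frac1T\ln\!\left(\frac{\delta'\big(w(1-F_\xi(\xi_T));0\big)}{\mathbb E[\xi_T]}\right).$$ -/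

import Mathlib

open MeasureTheory ProbabilityTheory Set

namespace MeanWVaR

noncomputable section

/-- The integral of an extended real function in `[-∞, ∞]`, i.e. the integral of the positive part
minus the integral of the negative part. In `EReal` one has `⊤ - ⊤ = ⊥`, so an integral of the
undefined form `∞ - ∞` is counted as `-∞`. -/
def extIntegral {α : Type*} [MeasurableSpace α] (m : Measure α) (f : α → EReal) : EReal :=
  ((∫⁻ a, (f a).toENNReal ∂m : ENNReal) : EReal) - ((∫⁻ a, (-f a).toENNReal ∂m : ENNReal) : EReal)

/-- A standard one-dimensional Brownian motion `(W t)`, `0 ≤ t ≤ T`. Only the restriction of `W` to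
`[0, T]` matters. -/
structure IsBrownianMotionOn {Ω : Type*} [MeasurableSpace Ω] (P : Measure Ω) (T : ℝ)
    (W : ℝ → Ω → ℝ) : Prop where
  measurable : ∀ t ∈ Icc 0 T, Measurable (W t)
  start : ∀ᵐ ω ∂P, W 0 ω = 0
  continuous : ∀ᵐ ω ∂P, ContinuousOn (fun t => W t ω) (Icc 0 T)
  indep : HasIndepIncrements (fun (t : Icc (0 : ℝ) T) => W t) P
  gaussian : ∀ s t : ℝ, 0 ≤ s → s ≤ t → t ≤ T →
    P.map (fun ω => W t ω - W s ω) = gaussianReal 0 (t - s).toNNReal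

/-- The σ-algebra generated by `(W s)`, `0 ≤ s ≤ t`, augmented by the `P`-null sets. -/
abbrev augmentedSigma {Ω : Type*} [MeasurableSpace Ω] (P : Measure Ω) (W : ℝ → Ω → ℝ) (t : ℝ) :
    MeasurableSpace Ω :=
  eventuallyMeasurableSpace
    (⨆ s ∈ Icc 0 t, MeasurableSpace.comap (W s) (inferInstance : MeasurableSpace ℝ)) (ae P)

/-- The state price density (pricing kernel): the geometric Brownian motion that solves
`dξ / ξ = -r dt - θ dW`, `ξ 0 = 1`, for the market price of risk `θ = (μ - r) / σ`. -/
def stateDensity {Ω : Type*} (r μ σ : ℝ) (W : ℝ → Ω → ℝ) (t : ℝ) (ω : Ω) : ℝ :=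
  Real.exp (-(r + ((μ - r) / σ) ^ 2 / 2) * t - ((μ - r) / σ) * W t ω)

/-- The log-return `(1 / T) ln (X / x)` of a terminal wealth `X ≥ 0`, with `ln 0 = -∞`. -/
def logReturn {Ω : Type*} (T x : ℝ) (X : Ω → ℝ) (ω : Ω) : EReal :=
  ((1 / T : ℝ) : EReal) * ENNReal.log (ENNReal.ofReal (X ω / x))

/-- The distribution function of an extended real random variable. -/
def distFun {Ω : Type*} [MeasurableSpace Ω] (P : Measure Ω) (R : Ω → EReal) (y : ℝ) : ℝ :=
  P.real {ω | R ω ≤ (y : EReal)}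

/-- The right-continuous quantile function `G z = inf {y ∈ ℝ | F y > z}` for `0 ≤ z < 1`, extended
by `G 1 = lim_{z ↑ 1} G z`; the limit is a supremum as `G` is nondecreasing. -/
def quantile {Ω : Type*} [MeasurableSpace Ω] (P : Measure Ω) (R : Ω → EReal) (z : ℝ) : EReal :=
  if z < 1 then ⨅ (y : ℝ) (_ : z < distFun P R y), (y : EReal)
  else ⨆ u ∈ Ico (0 : ℝ) 1, ⨅ (y : ℝ) (_ : u < distFun P R y), (y : EReal)

/-- The weighted Value-at-Risk with weighting measure `Φ` on `[0, 1]`. -/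
def wvar {Ω : Type*} [MeasurableSpace Ω] (P : Measure Ω) (Φ : Measure ℝ) (R : Ω → EReal) : EReal :=
  -extIntegral (Φ.restrict (Icc 0 1)) (quantile P R)

/-- The mean-WVaR objective `l E[R] - ρ_Φ(R)`. -/
def meanWVaR {Ω : Type*} [MeasurableSpace Ω] (P : Measure Ω) (Φ : Measure ℝ) (l : ℝ)
    (R : Ω → EReal) : EReal :=
  (l : EReal) * extIntegral P R - wvar P Φ R

/-- The terminal wealths admitted in the static problem with state price density `ξ` and initial
endowment `x`: `𝓕`-measurable, `X ≥ 0` almost surely, and `E[ξ X] ≤ x`. -/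
structure IsFeasible {Ω : Type*} (𝓕 : MeasurableSpace Ω) [MeasurableSpace Ω] (P : Measure Ω)
    (ξ : Ω → ℝ) (x : ℝ) (X : Ω → ℝ) : Prop where
  measurable : Measurable[𝓕] X
  nonneg : ∀ᵐ ω ∂P, 0 ≤ X ω
  integrable : Integrable (fun ω => ξ ω * X ω) P
  budget : ∫ ω, ξ ω * X ω ∂P ≤ x

/-- `X` maximizes `l E[R] - ρ_Φ(R)` over all feasible terminal wealths. -/
def IsMeanWVaROptimal {Ω : Type*} (𝓕 : MeasurableSpace Ω) [MeasurableSpace Ω] (P : Measure Ω)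
    (ξ : Ω → ℝ) (T x : ℝ) (Φ : Measure ℝ) (l : ℝ) (X : Ω → ℝ) : Prop :=
  IsFeasible 𝓕 P ξ x X ∧ ∀ Y : Ω → ℝ, IsFeasible 𝓕 P ξ x Y →
    meanWVaR P Φ l (logReturn T x Y) ≤ meanWVaR P Φ l (logReturn T x X)

/-- `X` minimizes `ρ_Φ(R)` over all feasible terminal wealths. -/
def IsMinRiskOptimal {Ω : Type*} (𝓕 : MeasurableSpace Ω) [MeasurableSpace Ω] (P : Measure Ω)
    (ξ : Ω → ℝ) (T x : ℝ) (Φ : Measure ℝ) (X : Ω → ℝ) : Prop :=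
  IsFeasible 𝓕 P ξ x X ∧ ∀ Y : Ω → ℝ, IsFeasible 𝓕 P ξ x Y →
    wvar P Φ (logReturn T x X) ≤ wvar P Φ (logReturn T x Y)

/-- `w s = (∫_{[0,s)} G_ξ(1 - z) dz) / E[ξ]`; the quantile `G_ξ(1 - z)` is finite for `0 < z`. -/
def wFun {Ω : Type*} [MeasurableSpace Ω] (P : Measure Ω) (ξ : Ω → ℝ) (s : ℝ) : ℝ :=
  (∫ z in Ico 0 s, (quantile P (fun ω => (ξ ω : EReal)) (1 - z)).toReal) / ∫ ω, ξ ω ∂P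

/-- The inverse of `w : [0, 1] → [0, 1]`. -/
def wInv {Ω : Type*} [MeasurableSpace Ω] (P : Measure Ω) (ξ : Ω → ℝ) : ℝ → ℝ :=
  Function.invFunOn (wFun P ξ) (Icc 0 1)

/-- `φ(s-; l) = (Φ([0, w⁻¹ s)) + l w⁻¹ s) / (1 + l)` for `s ∈ [0, 1]`. -/
def phiLeft {Ω : Type*} [MeasurableSpace Ω] (P : Measure Ω) (ξ : Ω → ℝ) (Φ : Measure ℝ) (l : ℝ)
    (s : ℝ) : ℝ :=
  (Φ.real (Ico 0 (wInv P ξ s)) + l * wInv P ξ s) / (1 + l)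

/-- The convex envelope of `f` on `S`: the pointwise largest convex function on `S` that is
dominated by `f` on `S`. -/
def convexEnvelope (S : Set ℝ) (f : ℝ → ℝ) (s : ℝ) : ℝ :=
  sSup {y : ℝ | ∃ g : ℝ → ℝ, ConvexOn ℝ S g ∧ (∀ t ∈ S, g t ≤ f t) ∧ y = g s}

/-- `δ(·; l)`, the convex envelope of `φ(·-; l)` on `[0, 1]`. -/
def delta {Ω : Type*} [MeasurableSpace Ω] (P : Measure Ω) (ξ : Ω → ℝ) (Φ : Measure ℝ) (l : ℝ) :
    ℝ → ℝ :=
  convexEnvelope (Icc 0 1) (phiLeft P ξ Φ l)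

/-- The right derivative `δ'(s; l)`, for `s ∈ [0, 1)`. -/
def deltaRight {Ω : Type*} [MeasurableSpace Ω] (P : Measure Ω) (ξ : Ω → ℝ) (Φ : Measure ℝ) (l : ℝ)
    (s : ℝ) : ℝ :=
  derivWithin (delta P ξ Φ l) (Ioi s) s

/-- `w(1 - F_ξ(ξ))`. -/
def rankVar {Ω : Type*} [MeasurableSpace Ω] (P : Measure Ω) (ξ : Ω → ℝ) (ω : Ω) : ℝ :=
  wFun P ξ (1 - distFun P (fun ω' => (ξ ω' : EReal)) (ξ ω))

/-- The efficient terminal wealth `(x / E[ξ]) δ'(w(1 - F_ξ(ξ)); l)`. -/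
def efficientWealth {Ω : Type*} [MeasurableSpace Ω] (P : Measure Ω) (ξ : Ω → ℝ) (x : ℝ)
    (Φ : Measure ℝ) (l : ℝ) (ω : Ω) : ℝ :=
  x / (∫ ω', ξ ω' ∂P) * deltaRight P ξ Φ l (rankVar P ξ ω)

end

end MeanWVaR

/-!
No duality over quantile functions is needed: for each level `y` one compares only the events on
which the log-return stays below `y`.

By the layer-cake formula the objective `l E[R] - ρ_Φ(R)` is, up to the sign conventions at `y = 0`,
minus the integral over `y` of `(1 + l) ψ(P(R < y))`, with
`ψ(t) = (Φ([0, t)) + l t) / (1 + l)` (`meanWVaR_eq`), and the budget `E[ξ X]` is `x T` times the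
integral over `y` of `e^{Ty} E[ξ; R ≥ y]` (`lintegral_budget`). Attaching the constant Lagrange
multiplier of the budget therefore leaves, at each level `y`, the problem of minimizing
`ψ(P(A)) - e^{Ty} E[ξ; A]` over events `A`.

Among the events of probability `t` the largest value of `E[ξ; A]` is `E[ξ] w(t)`, attained only at
the event that the decreasing rank `1 - F_ξ(ξ)` is below `t` (`setIntegral_le_wFun`). In the variable
`s = w(t)` this leaves the minimization of `φ(s-) - c s` with `c = E[ξ] e^{Ty}`. A minimizer `s`
exists by lower semicontinuity. The affine function of slope `c` through the graph at `s` minorizes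
`φ(·-)`, hence also its convex envelope `δ`, which it touches at `s`, so that `δ' ≤ c` to the left of
`s` and `δ' ≥ c` to the right (`rightDeriv_of_isMinOn`). Unless `c` is one of the countably many atoms
of `δ'(w(1 - F_ξ(ξ)))`, the optimal event is thus `{δ'(w(1 - F_ξ(ξ))) < c}`, up to null sets, and this
is the event that the log-return of the efficient wealth is below `y` (`weightCdf_sub_le`).

Integration over `y` gives optimality, as the efficient wealth exhausts the budget by
`∫ δ' = δ(1) - δ(0) = 1`. The latter needs `Φ({1}) = 0`, which keeps `δ` continuous at `1`. If the
optimal value is finite, equality of the objectives forces equality at almost every level `y`, so that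
the events `{R < y}` of an optimal log-return agree with those of the efficient one, which gives
uniqueness (`gainPart_add_lossPart_le`).
-/

namespace MeanWVaR

/-! ### Quantile functions -/

theorem quantile_lt_iff {Ω : Type*} [MeasurableSpace Ω] {P : Measure Ω} [IsProbabilityMeasure P]
    {R : Ω → EReal} {z y : ℝ} (hz : z < 1) :
    quantile P R z < y ↔ z < P.real {ω | R ω < y} := by
  rw [quantile, if_pos hz]
  simp only [iInf_lt_iff, EReal.coe_lt_coe_iff, exists_prop]
  constructor
  · rintro ⟨y', h, hy⟩
    refine h.trans_le (measureReal_mono fun ω hω => ?_)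
    exact lt_of_le_of_lt hω (EReal.coe_lt_coe_iff.2 hy)
  · intro h
    have hmono : Monotone fun n : ℕ => {ω | R ω ≤ ((y - 1 / ((n : ℝ) + 1) : ℝ) : EReal)} := by
      intro m n hmn ω hω
      refine le_trans (show R ω ≤ _ from hω) (EReal.coe_le_coe_iff.2 ?_)
      have := Nat.one_div_le_one_div (α := ℝ) hmn
      linarith
    have hunion : ⋃ n : ℕ, {ω | R ω ≤ ((y - 1 / ((n : ℝ) + 1) : ℝ) : EReal)} = {ω | R ω < y} := by
      ext ω
      simp only [mem_iUnion, mem_ofPred_eq]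
      constructor
      · rintro ⟨n, hn⟩
        refine lt_of_le_of_lt hn (EReal.coe_lt_coe_iff.2 ?_)
        have : (0 : ℝ) < 1 / ((n : ℝ) + 1) := by positivity
        linarith
      · intro hω
        obtain ⟨a, ha, hay⟩ := EReal.lt_iff_exists_real_btwn.1 hω
        obtain ⟨n, hn⟩ := exists_nat_one_div_lt (sub_pos.2 (EReal.coe_lt_coe_iff.1 hay))
        exact ⟨n, ha.le.trans (EReal.coe_le_coe_iff.2 (by linarith))⟩
    have ht := tendsto_measure_iUnion_atTop (μ := P) hmono
    rw [hunion] at ht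
    have ht' := (ENNReal.tendsto_toReal (measure_ne_top P {ω | R ω < y})).comp ht
    obtain ⟨n, hn⟩ := (ht'.eventually (lt_mem_nhds h)).exists
    exact ⟨_, hn, sub_lt_self _ (by positivity)⟩

theorem monotone_quantile {Ω : Type*} [MeasurableSpace Ω] (P : Measure Ω) (R : Ω → EReal) :
    Monotone (quantile P R) := by
  have key : ∀ {a b : ℝ}, a ≤ b → (⨅ (y : ℝ) (_ : a < distFun P R y), (y : EReal)) ≤
      ⨅ (y : ℝ) (_ : b < distFun P R y), (y : EReal) := fun {a b} hab =>
    le_iInf₂ fun y hy =>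
      iInf₂_le (f := fun (y : ℝ) (_ : a < distFun P R y) => (y : EReal)) y (hab.trans_lt hy)
  intro a b hab
  rw [quantile, quantile]
  by_cases hb : b < 1
  · rw [if_pos hb, if_pos (hab.trans_lt hb)]
    exact key hab
  · rw [if_neg hb]
    by_cases ha : a < 1
    · rw [if_pos ha]
      have hm : max a 0 ∈ Ico (0 : ℝ) 1 := ⟨le_max_right _ _, max_lt ha one_pos⟩
      exact (key (le_max_left a 0)).trans
        (le_iSup₂ (f := fun u (_ : u ∈ Ico (0 : ℝ) 1) =>
          ⨅ (y : ℝ) (_ : u < distFun P R y), (y : EReal)) _ hm)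
    · rw [if_neg ha]

/-! ### State price densities with a continuous, fully supported distribution -/

/-- The properties of the terminal state price density on which the optimization rests: positive
and integrable, with a distribution that has no atoms and charges every subinterval of `(0, ∞)`. -/
structure IsRegularDensity {Ω : Type*} [MeasurableSpace Ω] (P : Measure Ω) (ξ : Ω → ℝ) :
    Prop where
  measurable : Measurable ξ
  pos : ∀ ω, 0 < ξ ω
  integrable : Integrable ξ P
  measure_eq : ∀ a, P {ω | ξ ω = a} = 0
  measure_Ioo_pos : ∀ a b, 0 < a → a < b → 0 < P {ω | ξ ω ∈ Ioo a b}

/-- The decreasing rank `1 - F_ξ(ξ)`, uniformly distributed on `[0, 1]`. -/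
noncomputable def survRank {Ω : Type*} [MeasurableSpace Ω] (P : Measure Ω) (ξ : Ω → ℝ) (ω : Ω) :
    ℝ :=
  1 - distFun P (fun ω' => (ξ ω' : EReal)) (ξ ω)

theorem distFun_coe {Ω : Type*} [MeasurableSpace Ω] (P : Measure Ω) (ξ : Ω → ℝ) (y : ℝ) :
    distFun P (fun ω => (ξ ω : EReal)) y = P.real {ω | ξ ω ≤ y} := by
  simp [distFun]

theorem monotone_distFun {Ω : Type*} [MeasurableSpace Ω] (P : Measure Ω) [IsFiniteMeasure P]
    (R : Ω → EReal) : Monotone (distFun P R) := fun _ _ h =>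
  measureReal_mono fun _ hω => le_trans (show _ ≤ _ from hω) (EReal.coe_le_coe_iff.2 h)

/-- A finite measure on the unit interval is determined by the masses of `[0, t)`. -/
theorem map_eq_smul_volume_of_measure_lt {Ω : Type*} [MeasurableSpace Ω] {ν : Measure Ω}
    [IsFiniteMeasure ν] {f : Ω → ℝ} (hf : Measurable f) (hf01 : ∀ ω, f ω ∈ Icc (0 : ℝ) 1)
    (k : ENNReal) (hk : k ≠ ⊤) (hν : ν univ = k)
    (h : ∀ t ∈ Ioo (0 : ℝ) 1, ν {ω | f ω < t} = k * ENNReal.ofReal t) :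
    ν.map f = k • volume.restrict (Icc (0 : ℝ) 1) := by
  have : IsFiniteMeasure (k • volume.restrict (Icc (0 : ℝ) 1)) :=
    (Measure.smul_finite _ hk)
  have hIio : ∀ t : ℝ, ν.map f (Iio t) = (k • volume.restrict (Icc (0 : ℝ) 1)) (Iio t) := by
    intro t
    rw [Measure.map_apply hf measurableSet_Iio, Measure.smul_apply, smul_eq_mul,
      Measure.restrict_apply measurableSet_Iio]
    change ν {ω | f ω < t} = _
    rcases le_or_gt t 0 with ht | ht
    · have h1 : {ω | f ω < t} = ∅ := by
        ext ω; simpa using ht.trans (hf01 ω).1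
      have h2 : Iio t ∩ Icc (0 : ℝ) 1 = ∅ := by
        ext s; simp only [mem_inter_iff, mem_Iio, mem_Icc, mem_empty_iff_false, iff_false]
        intro hs
        linarith [hs.1, hs.2.1]
      rw [h1, h2]; simp
    rcases lt_or_ge t 1 with ht1 | ht1
    · have h2 : Iio t ∩ Icc (0 : ℝ) 1 = Ico 0 t := by
        ext s; simp only [mem_inter_iff, mem_Iio, mem_Icc, mem_Ico]
        constructor
        · exact fun hs => ⟨hs.2.1, hs.1⟩
        · exact fun hs => ⟨hs.2, hs.1, (hs.2.trans ht1).le⟩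
      rw [h _ ⟨ht, ht1⟩, h2]; simp
    rcases eq_or_lt_of_le ht1 with rfl | ht1
    · -- at `t = 1` the mass is the supremum of the masses below `t < 1`
      have h2 : Iio (1 : ℝ) ∩ Icc (0 : ℝ) 1 = Ico 0 1 := by
        ext s; simp only [mem_inter_iff, mem_Iio, mem_Icc, mem_Ico]
        constructor
        · exact fun hs => ⟨hs.2.1, hs.1⟩
        · exact fun hs => ⟨hs.2, hs.1, hs.2.le⟩
      rw [h2]
      simp only [Real.volume_Ico, sub_zero, ENNReal.ofReal_one, mul_one]
      refine le_antisymm ((measure_mono (subset_univ _)).trans hν.le) ?_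
      have hlim : Filter.Tendsto (fun n : ℕ => k * ENNReal.ofReal (1 - 1 / ((n : ℝ) + 2)))
          Filter.atTop (nhds (k * ENNReal.ofReal 1)) := by
        refine ENNReal.Tendsto.const_mul (ENNReal.tendsto_ofReal ?_) (Or.inr hk)
        have := (tendsto_const_div_atTop_nhds_zero_nat (1 : ℝ)).comp (Filter.tendsto_add_atTop_nat 2)
        simpa [Function.comp_def] using this.const_sub 1
      simp only [ENNReal.ofReal_one, mul_one] at hlim
      refine le_of_tendsto' hlim fun n => ?_
      have hn : (1 : ℝ) / ((n : ℝ) + 2) < 1 := by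
        rw [div_lt_one (by positivity)]; linarith [(Nat.cast_nonneg n : (0 : ℝ) ≤ n)]
      have hn' : (0 : ℝ) < 1 / ((n : ℝ) + 2) := by positivity
      rw [← h _ ⟨by linarith, by linarith⟩]
      exact measure_mono fun ω hω => lt_trans (show f ω < _ from hω) (by linarith)
    · have h1 : {ω | f ω < t} = univ := by
        ext ω; simpa using (hf01 ω).2.trans_lt ht1
      have h2 : Iio t ∩ Icc (0 : ℝ) 1 = Icc 0 1 :=
        inter_eq_right.2 fun s hs => hs.2.trans_lt ht1
      rw [h1, h2, hν]; simp
  have : IsFiniteMeasure (ν.map f) := Measure.isFiniteMeasure_map ν f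
  refine Measure.ext_of_Ici _ _ fun a => ?_
  rw [← compl_Iio, measure_compl measurableSet_Iio (measure_ne_top _ _),
    measure_compl measurableSet_Iio (measure_ne_top _ _), hIio, Measure.map_apply hf MeasurableSet.univ,
    preimage_univ, hν]
  simp

namespace IsRegularDensity

variable {Ω : Type*} [MeasurableSpace Ω] {P : Measure Ω} {ξ : Ω → ℝ}

theorem distFun_of_nonpos (h : IsRegularDensity P ξ) {y : ℝ} (hy : y ≤ 0) :
    distFun P (fun ω => (ξ ω : EReal)) y = 0 := by
  rw [distFun_coe]
  have : {ω | ξ ω ≤ y} = ∅ := by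
    ext ω; simpa using hy.trans_lt (h.pos ω)
  simp [this]

theorem measurable_quantile_sub :
    Measurable fun z => (quantile P (fun ω => (ξ ω : EReal)) (1 - z)).toReal :=
  measurable_ereal_toReal.comp
    ((monotone_quantile P _).measurable.comp (measurable_const.sub measurable_id))

theorem wFun_zero : wFun P ξ 0 = 0 := by simp [wFun]

variable [IsProbabilityMeasure P]

theorem continuous_distFun (h : IsRegularDensity P ξ) :
    Continuous (distFun P fun ω => (ξ ω : EReal)) := by
  have : IsProbabilityMeasure (P.map ξ) := Measure.isProbabilityMeasure_map h.measurable.aemeasurable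
  have heq : (distFun P fun ω => (ξ ω : EReal)) = cdf (P.map ξ) := by
    ext y
    rw [distFun_coe, cdf_eq_real, map_measureReal_apply h.measurable measurableSet_Iic]
    rfl
  rw [heq, continuous_iff_continuousAt]
  intro a
  rw [(monotone_cdf _).continuousAt_iff_leftLim_eq_rightLim, StieltjesFunction.rightLim_eq]
  have hs : (cdf (P.map ξ)).measure {a} = 0 := by
    rw [measure_cdf, Measure.map_apply h.measurable (measurableSet_singleton a)]
    exact h.measure_eq a
  rw [StieltjesFunction.measure_singleton, ENNReal.ofReal_eq_zero] at hs
  exact le_antisymm ((monotone_cdf _).leftLim_le le_rfl) (by linarith)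

theorem distFun_lt_distFun (h : IsRegularDensity P ξ) {a b : ℝ} (ha : 0 ≤ a) (hab : a < b) :
    distFun P (fun ω => (ξ ω : EReal)) a < distFun P (fun ω => (ξ ω : EReal)) b := by
  rw [distFun_coe, distFun_coe]
  have h1 := h.measure_Ioo_pos ((a + b) / 2) b (by linarith) (by linarith)
  have hdisj : Disjoint {ω | ξ ω ≤ a} {ω | ξ ω ∈ Ioo ((a + b) / 2) b} :=
    disjoint_left.2 fun ω h1 h2 => by
      have h1' : ξ ω ≤ a := h1
      have h2' := h2.1
      linarith
  have h2 := measureReal_union (μ := P) hdisj (h.measurable measurableSet_Ioo)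
  have h3 : P.real ({ω | ξ ω ≤ a} ∪ {ω | ξ ω ∈ Ioo ((a + b) / 2) b}) ≤ P.real {ω | ξ ω ≤ b} :=
    measureReal_mono (union_subset (fun ω (hω : ξ ω ≤ a) => hω.trans hab.le) fun ω hω => hω.2.le)
  have h4 : 0 < P.real {ω | ξ ω ∈ Ioo ((a + b) / 2) b} :=
    ENNReal.toReal_pos h1.ne' (measure_ne_top _ _)
  linarith

theorem distFun_le_distFun_iff (h : IsRegularDensity P ξ) {a b : ℝ} (hb : 0 ≤ b) :
    distFun P (fun ω => (ξ ω : EReal)) a ≤ distFun P (fun ω => (ξ ω : EReal)) b ↔ a ≤ b :=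
  ⟨fun h1 => not_lt.1 fun h2 => (h.distFun_lt_distFun hb h2).not_ge h1,
    fun h1 => monotone_distFun _ _ h1⟩

theorem distFun_le_one (y : ℝ) : distFun P (fun ω => (ξ ω : EReal)) y ≤ 1 := measureReal_le_one

theorem exists_distFun_eq (h : IsRegularDensity P ξ) {u : ℝ} (hu : u ∈ Ioo (0 : ℝ) 1) :
    ∃ c, 0 < c ∧ distFun P (fun ω => (ξ ω : EReal)) c = u := by
  have hu0 : ∃ a, distFun P (fun ω => (ξ ω : EReal)) a ≤ u :=
    ⟨0, by rw [h.distFun_of_nonpos le_rfl]; exact hu.1.le⟩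
  have hu1 : ∃ b, u ≤ distFun P (fun ω => (ξ ω : EReal)) b := by
    have : IsProbabilityMeasure (P.map ξ) :=
      Measure.isProbabilityMeasure_map h.measurable.aemeasurable
    obtain ⟨b, hb⟩ := ((tendsto_cdf_atTop (P.map ξ)).eventually (lt_mem_nhds hu.2)).exists
    refine ⟨b, ?_⟩
    rw [distFun_coe]
    rw [cdf_eq_real, map_measureReal_apply h.measurable measurableSet_Iic] at hb
    exact hb.le
  obtain ⟨c, hc⟩ := mem_range_of_exists_le_of_exists_ge h.continuous_distFun hu0 hu1
  refine ⟨c, not_le.1 fun hc0 => ?_, hc⟩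
  rw [h.distFun_of_nonpos hc0] at hc
  exact hu.1.ne hc

theorem quantile_distFun (h : IsRegularDensity P ξ) {y : ℝ} (hy : 0 < y) :
    quantile P (fun ω => (ξ ω : EReal)) (distFun P (fun ω => (ξ ω : EReal)) y) = y := by
  have h1 : distFun P (fun ω => (ξ ω : EReal)) y < 1 :=
    (h.distFun_lt_distFun hy.le (lt_add_one y)).trans_le (distFun_le_one _)
  rw [quantile, if_pos h1]
  refine le_antisymm (le_of_forall_gt_imp_ge_of_dense fun v hv => ?_) (le_iInf₂ fun y' hy' => ?_)
  · obtain ⟨a, ha, hav⟩ := EReal.lt_iff_exists_real_btwn.1 hv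
    exact (iInf₂_le a (h.distFun_lt_distFun hy.le (EReal.coe_lt_coe_iff.1 ha))).trans hav.le
  · refine EReal.coe_le_coe_iff.2 (not_lt.1 fun h2 => ?_)
    exact (monotone_distFun P _ h2.le).not_gt hy'

theorem survRank_mem (h : IsRegularDensity P ξ) (ω : Ω) : survRank P ξ ω ∈ Ioo (0 : ℝ) 1 := by
  rw [survRank]
  have h1 := (h.distFun_lt_distFun (h.pos ω).le (lt_add_one (ξ ω))).trans_le (distFun_le_one _)
  have h2 := h.distFun_lt_distFun le_rfl (h.pos ω)
  rw [h.distFun_of_nonpos le_rfl] at h2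
  exact ⟨by linarith, by linarith⟩

theorem measurable_survRank (h : IsRegularDensity P ξ) : Measurable (survRank P ξ) :=
  measurable_const.sub ((monotone_distFun P _).measurable.comp h.measurable)

theorem survRank_lt_iff (h : IsRegularDensity P ξ) {c : ℝ} (hc : 0 < c) {p : ℝ}
    (hcp : distFun P (fun ω => (ξ ω : EReal)) c = 1 - p) (ω : Ω) :
    survRank P ξ ω < p ↔ c < ξ ω := by
  rw [survRank, sub_lt_comm, ← hcp, ← not_le, h.distFun_le_distFun_iff hc.le, not_le]

theorem measure_survRank_lt (h : IsRegularDensity P ξ) {t : ℝ} (ht : t ∈ Ioo (0 : ℝ) 1) :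
    P {ω | survRank P ξ ω < t} = ENNReal.ofReal t := by
  obtain ⟨c, hc, hct⟩ := h.exists_distFun_eq (u := 1 - t) ⟨by linarith [ht.2], by linarith [ht.1]⟩
  have h1 : {ω | survRank P ξ ω < t} = {ω | ξ ω ≤ c}ᶜ := by
    ext ω; simp [h.survRank_lt_iff hc hct]
  rw [distFun_coe] at hct
  rw [← ofReal_measureReal, h1,
    probReal_compl_eq_one_sub (s := {ω | ξ ω ≤ c}) (h.measurable measurableSet_Iic)]
  congr 1
  linarith

theorem map_survRank (h : IsRegularDensity P ξ) :
    P.map (survRank P ξ) = volume.restrict (Icc (0 : ℝ) 1) := by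
  have := map_eq_smul_volume_of_measure_lt (ν := P) h.measurable_survRank
    (fun ω => Ioo_subset_Icc_self (h.survRank_mem ω)) 1 ENNReal.one_ne_top measure_univ
    (fun t ht => by rw [h.measure_survRank_lt ht, one_mul])
  simpa using this

theorem measureReal_survRank_lt (h : IsRegularDensity P ξ) {t : ℝ} (ht : t ∈ Icc (0 : ℝ) 1) :
    P.real {ω | survRank P ξ ω < t} = t := by
  have h1 : P {ω | survRank P ξ ω < t} = P.map (survRank P ξ) (Iio t) := by
    rw [Measure.map_apply h.measurable_survRank measurableSet_Iio]; rfl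
  have h2 : Iio t ∩ Icc (0 : ℝ) 1 = Ico 0 t := by
    ext s; simp only [mem_inter_iff, mem_Iio, mem_Icc, mem_Ico]
    constructor
    · exact fun hs => ⟨hs.2.1, hs.1⟩
    · exact fun hs => ⟨hs.2, hs.1, hs.2.le.trans ht.2⟩
  rw [measureReal_def, h1, h.map_survRank, Measure.restrict_apply measurableSet_Iio, h2]
  simp [ht.1]

theorem measure_survRank_eq (h : IsRegularDensity P ξ) (v : ℝ) :
    P {ω | survRank P ξ ω = v} = 0 := by
  have h1 : P {ω | survRank P ξ ω = v} = P.map (survRank P ξ) {v} := by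
    rw [Measure.map_apply h.measurable_survRank (measurableSet_singleton v)]; rfl
  rw [h1, h.map_survRank]
  simp

/-! ### The reparametrization `w` -/

theorem integral_pos (h : IsRegularDensity P ξ) : 0 < ∫ ω, ξ ω ∂P := by
  rw [integral_pos_iff_support_of_nonneg (fun ω => (h.pos ω).le) h.integrable]
  have : Function.support ξ = univ := by
    ext ω; simpa using (h.pos ω).ne'
  simp [this]

theorem quantile_survRank (h : IsRegularDensity P ξ) (ω : Ω) :
    (quantile P (fun ω => (ξ ω : EReal)) (1 - survRank P ξ ω)).toReal = ξ ω := by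
  rw [survRank, sub_sub_cancel, h.quantile_distFun (h.pos ω), EReal.toReal_coe]

/-- The budget share of the event that `ξ` is among its `t` largest values. -/
theorem setIntegral_survRank_lt (h : IsRegularDensity P ξ) {t : ℝ} (ht : t ≤ 1) :
    ∫ ω in {ω | survRank P ξ ω < t}, ξ ω ∂P = (∫ ω, ξ ω ∂P) * wFun P ξ t := by
  have h2 : Iio t ∩ Icc (0 : ℝ) 1 = Ico 0 t := by
    ext s; simp only [mem_inter_iff, mem_Iio, mem_Icc, mem_Ico]
    constructor
    · exact fun hs => ⟨hs.2.1, hs.1⟩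
    · exact fun hs => ⟨hs.2, hs.1, hs.2.le.trans ht⟩
  rw [wFun, mul_div_cancel₀ _ h.integral_pos.ne', ← h2,
    ← Measure.restrict_restrict measurableSet_Iio, ← h.map_survRank,
    setIntegral_map measurableSet_Iio measurable_quantile_sub.aestronglyMeasurable
      h.measurable_survRank.aemeasurable]
  simp only [h.quantile_survRank]
  rfl

theorem integrableOn_quantile (h : IsRegularDensity P ξ) :
    IntegrableOn (fun z => (quantile P (fun ω => (ξ ω : EReal)) (1 - z)).toReal)
      (Icc (0 : ℝ) 1) := by
  rw [IntegrableOn, ← h.map_survRank,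
    integrable_map_measure measurable_quantile_sub.aestronglyMeasurable
      h.measurable_survRank.aemeasurable]
  simpa only [Function.comp_def, h.quantile_survRank] using h.integrable

theorem wFun_one (h : IsRegularDensity P ξ) : wFun P ξ 1 = 1 := by
  have h1 := h.setIntegral_survRank_lt le_rfl
  have h2 : {ω | survRank P ξ ω < 1} = univ := by
    ext ω; simpa using (h.survRank_mem ω).2
  rw [h2, Measure.restrict_univ] at h1
  exact (mul_right_injective₀ h.integral_pos.ne' (by simpa using h1)).symm

theorem strictMonoOn_wFun (h : IsRegularDensity P ξ) : StrictMonoOn (wFun P ξ) (Icc 0 1) := by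
  intro s hs t ht hst
  refine lt_of_mul_lt_mul_left ?_ h.integral_pos.le
  rw [← h.setIntegral_survRank_lt hs.2, ← h.setIntegral_survRank_lt ht.2]
  have hsub : {ω | survRank P ξ ω < s} ⊆ {ω | survRank P ξ ω < t} :=
    fun ω hω => lt_trans hω hst
  have hms := h.measurable_survRank (measurableSet_Iio (a := s))
  have hmt := h.measurable_survRank (measurableSet_Iio (a := t))
  have h1 := setIntegral_union (μ := P) (f := ξ)
    (disjoint_sdiff_right (s := {ω | survRank P ξ ω < s}) (t := {ω | survRank P ξ ω < t}))
    (hmt.diff hms) h.integrable.integrableOn h.integrable.integrableOn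
  rw [union_sdiff_cancel hsub] at h1
  have h2 : 0 < ∫ ω in {ω | survRank P ξ ω < t} \ {ω | survRank P ξ ω < s}, ξ ω ∂P := by
    rw [setIntegral_pos_iff_support_of_nonneg_ae
      (Filter.Eventually.of_forall fun ω => (h.pos ω).le) h.integrable.integrableOn]
    have : Function.support ξ = univ := by
      ext ω; simpa using (h.pos ω).ne'
    rw [this, univ_inter]
    refine (ENNReal.toReal_pos_iff.1 (?_ : 0 < P.real _)).1
    rw [measureReal_sdiff hsub hms, h.measureReal_survRank_lt hs, h.measureReal_survRank_lt ht]
    linarith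
  linarith

theorem continuousOn_wFun (h : IsRegularDensity P ξ) : ContinuousOn (wFun P ξ) (Icc 0 1) := by
  refine ContinuousOn.div_const ?_ _
  refine (intervalIntegral.continuousOn_primitive h.integrableOn_quantile).congr fun t _ => ?_
  exact integral_Ico_eq_integral_Ioo.trans integral_Ioc_eq_integral_Ioo.symm

theorem wFun_mem (h : IsRegularDensity P ξ) {t : ℝ} (ht : t ∈ Icc (0 : ℝ) 1) :
    wFun P ξ t ∈ Icc (0 : ℝ) 1 := by
  have h0 := h.strictMonoOn_wFun.monotoneOn (left_mem_Icc.2 zero_le_one) ht ht.1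
  have h1 := h.strictMonoOn_wFun.monotoneOn ht (right_mem_Icc.2 zero_le_one) ht.2
  rw [wFun_zero] at h0
  rw [h.wFun_one] at h1
  exact ⟨h0, h1⟩

theorem exists_wFun_eq (h : IsRegularDensity P ξ) {s : ℝ} (hs : s ∈ Icc (0 : ℝ) 1) :
    ∃ t ∈ Icc (0 : ℝ) 1, wFun P ξ t = s := by
  have := intermediate_value_Icc zero_le_one h.continuousOn_wFun
  rw [wFun_zero, h.wFun_one] at this
  exact this hs

theorem wInv_wFun (h : IsRegularDensity P ξ) {t : ℝ} (ht : t ∈ Icc (0 : ℝ) 1) :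
    wInv P ξ (wFun P ξ t) = t :=
  h.strictMonoOn_wFun.injOn.leftInvOn_invFunOn ht

theorem measurable_wFun (h : IsRegularDensity P ξ) :
    Measurable fun t => wFun P ξ (max 0 (min t 1)) := by
  refine Monotone.measurable fun a b hab => ?_
  refine h.strictMonoOn_wFun.monotoneOn ⟨le_max_left _ _, ?_⟩ ⟨le_max_left _ _, ?_⟩
    (max_le_max le_rfl (min_le_min hab le_rfl)) <;>
  exact max_le zero_le_one (min_le_right _ _)

/-! ### Events of given probability and extremal budget share -/

/-- Among the events of a given probability, the event that `ξ` is large has the largest budget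
share, and it is the only one, up to null sets. -/
theorem setIntegral_le_wFun (h : IsRegularDensity P ξ) {A : Set Ω} (hA : MeasurableSet A) :
    ∫ ω in A, ξ ω ∂P ≤ (∫ ω, ξ ω ∂P) * wFun P ξ (P.real A) ∧
    (∫ ω in A, ξ ω ∂P = (∫ ω, ξ ω ∂P) * wFun P ξ (P.real A) →
      A =ᵐ[P] {ω | survRank P ξ ω < P.real A}) := by
  set p := P.real A with hp
  have hp01 : p ∈ Icc (0 : ℝ) 1 := ⟨measureReal_nonneg, measureReal_le_one⟩
  rw [← h.setIntegral_survRank_lt hp01.2]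
  set B := {ω | survRank P ξ ω < p} with hBdef
  have hB : MeasurableSet B := h.measurable_survRank (measurableSet_Iio (a := p))
  have hPB : P.real B = p := h.measureReal_survRank_lt hp01
  by_cases hpp : p ∈ Ioo (0 : ℝ) 1
  · obtain ⟨c, hc, hcp⟩ := h.exists_distFun_eq (u := 1 - p)
      ⟨by linarith [hpp.2], by linarith [hpp.1]⟩
    have hmem : ∀ ω, ω ∈ B ↔ c < ξ ω := h.survRank_lt_iff hc hcp
    -- `(ξ - c) (1_B - 1_A)` is nonnegative, as `B` is the event that `ξ` exceeds `c`
    have hi : ∀ {S : Set Ω}, MeasurableSet S →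
        Integrable (S.indicator fun ω => ξ ω - c) P := fun hS =>
      (h.integrable.sub (integrable_const c)).indicator hS
    have hval : ∀ {S : Set Ω}, MeasurableSet S →
        ∫ ω, S.indicator (fun ω => ξ ω - c) ω ∂P = ∫ ω in S, ξ ω ∂P - P.real S * c := by
      intro S hS
      rw [integral_indicator hS, integral_sub h.integrable.integrableOn
        (integrable_const c).integrableOn]
      simp
    set D : Ω → ℝ := fun ω => B.indicator (fun ω => ξ ω - c) ω - A.indicator (fun ω => ξ ω - c) ω
      with hD
    have hD0 : ∀ ω, 0 ≤ D ω := by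
      intro ω
      have := hmem ω
      by_cases h1 : ω ∈ B <;> by_cases h2 : ω ∈ A <;> simp only [hD, indicator, h1, h2, if_true,
        if_false] <;> simp only [h1, true_iff, false_iff, not_lt] at this <;> linarith
    have hDint : ∫ ω, D ω ∂P = ∫ ω in B, ξ ω ∂P - ∫ ω in A, ξ ω ∂P := by
      rw [hD, integral_sub (hi hB) (hi hA), hval hB, hval hA, hPB, ← hp]
      ring
    refine ⟨by linarith [integral_nonneg (μ := P) (Pi.le_def.2 hD0)], fun heq => ?_⟩
    have hz : D =ᵐ[P] 0 := by
      rw [← integral_eq_zero_iff_of_nonneg hD0 ((hi hB).sub (hi hA)), hDint]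
      linarith
    have hne : ∀ᵐ ω ∂P, ξ ω ≠ c := by
      rw [ae_iff]; simpa using h.measure_eq c
    filter_upwards [hz, hne] with ω h1 h2
    refine propext ?_
    change ω ∈ A ↔ ω ∈ B
    have h3 : ξ ω - c ≠ 0 := sub_ne_zero.2 h2
    by_cases h4 : ω ∈ B <;> by_cases h5 : ω ∈ A <;>
      simp only [hD, indicator, h4, h5, if_true, if_false, Pi.zero_apply] at h1 ⊢
    · exact absurd (by linarith) h3
    · exact absurd (by linarith) h3
  · have hor : p = 0 ∨ p = 1 := by
      by_contra! hcon
      exact hpp ⟨lt_of_le_of_ne hp01.1 hcon.1.symm, lt_of_le_of_ne hp01.2 hcon.2⟩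
    have hAB : A =ᵐ[P] B := by
      rcases hor with h0 | h1
      · have hA0 : P A = 0 := by
          rw [← measureReal_eq_zero_iff]; exact hp.symm.trans h0
        have hB0 : P B = 0 := by
          rw [← measureReal_eq_zero_iff]; exact hPB.trans h0
        exact (ae_eq_empty.2 hA0).trans (ae_eq_empty.2 hB0).symm
      · have hone : ∀ {S : Set Ω}, MeasurableSet S → P.real S = 1 → S =ᵐ[P] univ := by
          intro S hS hS1
          rw [ae_eq_univ, ← measureReal_eq_zero_iff, probReal_compl_eq_one_sub hS, hS1, sub_self]
        exact (hone hA (hp.symm.trans h1)).trans (hone hB (hPB.trans h1)).symm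
    exact ⟨(setIntegral_congr_set hAB).le, fun _ => hAB⟩

end IsRegularDensity

/-! ### Convex envelopes -/

theorem le_convexEnvelope {S : Set ℝ} {f g : ℝ → ℝ} (hg : ConvexOn ℝ S g) (hgf : ∀ t ∈ S, g t ≤ f t)
    {s : ℝ} (hs : s ∈ S) : g s ≤ convexEnvelope S f s :=
  le_csSup ⟨f s, by rintro _ ⟨g', _, hg', rfl⟩; exact hg' s hs⟩ ⟨g, hg, hgf, rfl⟩

theorem convexEnvelope_le {S : Set ℝ} {f g : ℝ → ℝ} (hg : ConvexOn ℝ S g)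
    (hgf : ∀ t ∈ S, g t ≤ f t) {s b : ℝ}
    (h : ∀ g' : ℝ → ℝ, ConvexOn ℝ S g' → (∀ t ∈ S, g' t ≤ f t) → g' s ≤ b) :
    convexEnvelope S f s ≤ b :=
  csSup_le ⟨g s, g, hg, hgf, rfl⟩ (by rintro _ ⟨g', h1, h2, rfl⟩; exact h g' h1 h2)

theorem convexOn_convexEnvelope {S : Set ℝ} {f g : ℝ → ℝ} (hg : ConvexOn ℝ S g)
    (hgf : ∀ t ∈ S, g t ≤ f t) : ConvexOn ℝ S (convexEnvelope S f) := by
  refine ⟨hg.1, fun a ha b hb p q hp hq hpq => ?_⟩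
  refine convexEnvelope_le hg hgf fun g' h1 h2 => ?_
  refine (h1.2 ha hb hp hq hpq).trans ?_
  have h3 := le_convexEnvelope h1 h2 ha
  have h4 := le_convexEnvelope h1 h2 hb
  simp only [smul_eq_mul]
  gcongr

/-- A distribution function on `[0, 1]`, as far as its convex envelope is concerned: it starts at
`0`, stays in `[0, 1]` and has no jump at `1`. -/
structure IsUnitProfile (f : ℝ → ℝ) : Prop where
  zero : f 0 = 0
  nonneg : ∀ s ∈ Icc (0 : ℝ) 1, 0 ≤ f s
  le_one : ∀ s ∈ Icc (0 : ℝ) 1, f s ≤ 1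
  left_limit : ∀ ε > 0, ∃ a ∈ Ico (0 : ℝ) 1, ∀ s ∈ Icc a 1, 1 - ε ≤ f s

namespace IsUnitProfile

variable {f : ℝ → ℝ}

theorem convexOn (h : IsUnitProfile f) : ConvexOn ℝ (Icc 0 1) (convexEnvelope (Icc 0 1) f) :=
  convexOn_convexEnvelope (convexOn_const 0 (convex_Icc 0 1)) h.nonneg

theorem envelope_le (h : IsUnitProfile f) {s : ℝ} (hs : s ∈ Icc (0 : ℝ) 1) :
    convexEnvelope (Icc 0 1) f s ≤ f s :=
  convexEnvelope_le (convexOn_const 0 (convex_Icc 0 1)) h.nonneg fun _ _ h2 => h2 s hs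

theorem envelope_nonneg (h : IsUnitProfile f) {s : ℝ} (hs : s ∈ Icc (0 : ℝ) 1) :
    0 ≤ convexEnvelope (Icc 0 1) f s :=
  le_convexEnvelope (g := fun _ => 0) (convexOn_const 0 (convex_Icc 0 1)) h.nonneg hs

theorem envelope_zero (h : IsUnitProfile f) : convexEnvelope (Icc 0 1) f 0 = 0 := by
  have h0 : (0 : ℝ) ∈ Icc (0 : ℝ) 1 := left_mem_Icc.2 zero_le_one
  exact le_antisymm ((h.envelope_le h0).trans h.zero.le) (h.envelope_nonneg h0)

theorem affine_le_envelope {c m : ℝ} (hcm : ∀ t ∈ Icc (0 : ℝ) 1, c * t + m ≤ f t) {s : ℝ}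
    (hs : s ∈ Icc (0 : ℝ) 1) : c * s + m ≤ convexEnvelope (Icc 0 1) f s := by
  refine le_convexEnvelope (g := fun t => c * t + m) ⟨convex_Icc 0 1, ?_⟩ hcm hs
  intro a _ b _ p q _ _ hpq
  simp only [smul_eq_mul]
  have : m = (p + q) * m := by rw [hpq, one_mul]
  nlinarith [this]

/-- The absence of a jump at `1` yields affine minorants whose values at `1` are close to `1`. -/
theorem exists_affine_le (h : IsUnitProfile f) {ε : ℝ} (hε : 0 < ε) (hε1 : ε ≤ 1) :
    ∃ c m : ℝ, c + m = 1 - ε ∧ ∀ t ∈ Icc (0 : ℝ) 1, c * t + m ≤ f t := by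
  obtain ⟨a, ha, haf⟩ := h.left_limit ε hε
  have ha1 : 0 < 1 - a := by linarith [ha.2]
  refine ⟨(1 - ε) / (1 - a), -((1 - ε) / (1 - a) * a), ?_, fun t ht => ?_⟩
  · field_simp
    ring
  · have hc : 0 ≤ (1 - ε) / (1 - a) := div_nonneg (by linarith) ha1.le
    rcases le_total t a with hta | hta
    · exact le_trans (by nlinarith) (h.nonneg t ht)
    · refine le_trans ?_ (haf t ⟨hta, ht.2⟩)
      have : (1 - ε) / (1 - a) * (1 - a) = 1 - ε := div_mul_cancel₀ _ ha1.ne'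
      nlinarith [ht.2]

theorem envelope_one (h : IsUnitProfile f) : convexEnvelope (Icc 0 1) f 1 = 1 := by
  have h1 : (1 : ℝ) ∈ Icc (0 : ℝ) 1 := right_mem_Icc.2 zero_le_one
  refine le_antisymm ((h.envelope_le h1).trans (h.le_one 1 h1)) (le_of_forall_pos_le_add ?_)
  intro ε hε
  obtain ⟨c, m, hcm, hle⟩ := h.exists_affine_le (ε := min ε 1) (by positivity) (min_le_right _ _)
  have := affine_le_envelope hle h1
  linarith [min_le_left ε 1]

theorem continuousOn_envelope (h : IsUnitProfile f) :
    ContinuousOn (convexEnvelope (Icc 0 1) f) (Icc 0 1) := by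
  intro s hs
  rcases eq_or_lt_of_le hs.1 with rfl | hs0
  · rw [ContinuousWithinAt, h.envelope_zero]
    have hid : Filter.Tendsto (fun t : ℝ => t) (nhdsWithin 0 (Icc 0 1)) (nhds 0) :=
      Filter.tendsto_id.mono_left nhdsWithin_le_nhds
    refine tendsto_of_tendsto_of_tendsto_of_le_of_le' tendsto_const_nhds hid ?_ ?_
    · filter_upwards [self_mem_nhdsWithin] with t ht using h.envelope_nonneg ht
    · filter_upwards [self_mem_nhdsWithin] with t ht
      have := h.convexOn.2 (left_mem_Icc.2 zero_le_one) (right_mem_Icc.2 zero_le_one)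
        (sub_nonneg.2 ht.2) ht.1 (by ring)
      simpa [h.envelope_zero, h.envelope_one] using this
  rcases eq_or_lt_of_le hs.2 with rfl | hs1
  · rw [ContinuousWithinAt, h.envelope_one]
    refine tendsto_order.2 ⟨fun a ha => ?_, fun a ha => ?_⟩
    · obtain ⟨c, m, hcm, hle⟩ := h.exists_affine_le (ε := min ((1 - a) / 2) 1)
        (lt_min (by linarith) one_pos) (min_le_right _ _)
      have hval : a < c * 1 + m := by linarith [min_le_left ((1 - a) / 2) 1]
      have hcont : Continuous fun t : ℝ => c * t + m := by fun_prop
      filter_upwards [nhdsWithin_le_nhds (hcont.continuousAt.eventually (lt_mem_nhds hval)),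
        self_mem_nhdsWithin] with t ht1 ht2
      exact ht1.trans_le (affine_le_envelope hle ht2)
    · filter_upwards [self_mem_nhdsWithin] with t ht
      exact ((h.envelope_le ht).trans (h.le_one t ht)).trans_lt ha
  · have hint : s ∈ interior (Icc (0 : ℝ) 1) := by rw [interior_Icc]; exact ⟨hs0, hs1⟩
    exact ((h.convexOn.continuousOn_interior s hint).continuousAt
      (isOpen_interior.mem_nhds hint)).continuousWithinAt

/-! ### The right derivative of the envelope -/

theorem rightDeriv_le (h : IsUnitProfile f) {u s : ℝ} (hu : 0 < u) (hus : u < s) (hs : s ≤ 1) :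
    derivWithin (convexEnvelope (Icc 0 1) f) (Ioi u) u * (s - u) ≤
      convexEnvelope (Icc 0 1) f s - convexEnvelope (Icc 0 1) f u := by
  have hint : u ∈ interior (Icc (0 : ℝ) 1) := by rw [interior_Icc]; exact ⟨hu, hus.trans_le hs⟩
  have := h.convexOn.rightDeriv_le_slope_of_mem_interior hint ⟨by linarith, hs⟩ hus
  rwa [slope_def_field, le_div_iff₀ (sub_pos.2 hus)] at this

theorem le_rightDeriv (h : IsUnitProfile f) {u s : ℝ} (hs : 0 ≤ s) (hus : s < u) (hu : u < 1) :
    convexEnvelope (Icc 0 1) f u - convexEnvelope (Icc 0 1) f s ≤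
      derivWithin (convexEnvelope (Icc 0 1) f) (Ioi u) u * (u - s) := by
  have hint : u ∈ interior (Icc (0 : ℝ) 1) := by rw [interior_Icc]; exact ⟨by linarith, hu⟩
  have := (h.convexOn.slope_le_leftDeriv_of_mem_interior ⟨hs, by linarith⟩ hint hus).trans
    (h.convexOn.leftDeriv_le_rightDeriv_of_mem_interior hint)
  rwa [slope_def_field, div_le_iff₀ (sub_pos.2 hus)] at this

theorem rightDeriv_nonneg (h : IsUnitProfile f) {u : ℝ} (hu : u ∈ Ioo (0 : ℝ) 1) :
    0 ≤ derivWithin (convexEnvelope (Icc 0 1) f) (Ioi u) u := by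
  have h1 := h.le_rightDeriv le_rfl hu.1 hu.2
  rw [h.envelope_zero, sub_zero, sub_zero] at h1
  exact nonneg_of_mul_nonneg_left ((h.envelope_nonneg ⟨hu.1.le, hu.2.le⟩).trans h1) hu.1

theorem hasDerivWithinAt (h : IsUnitProfile f) {u : ℝ} (hu : u ∈ Ioo (0 : ℝ) 1) :
    HasDerivWithinAt (convexEnvelope (Icc 0 1) f)
      (derivWithin (convexEnvelope (Icc 0 1) f) (Ioi u) u) (Ioi u) u :=
  h.convexOn.hasDerivWithinAt_rightDeriv_of_mem_interior (by rwa [interior_Icc])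

theorem integrableOn_rightDeriv (h : IsUnitProfile f) :
    IntegrableOn (fun u => derivWithin (convexEnvelope (Icc 0 1) f) (Ioi u) u) (Ioc 0 1) :=
  intervalIntegral.integrableOn_deriv_right_of_nonneg h.continuousOn_envelope
    (fun _ => h.hasDerivWithinAt) fun _ => h.rightDeriv_nonneg

theorem integral_rightDeriv (h : IsUnitProfile f) :
    ∫ u in Icc (0 : ℝ) 1, derivWithin (convexEnvelope (Icc 0 1) f) (Ioi u) u = 1 := by
  rw [integral_Icc_eq_integral_Ioc, ← intervalIntegral.integral_of_le zero_le_one,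
    intervalIntegral.integral_eq_sub_of_hasDeriv_right_of_le zero_le_one h.continuousOn_envelope
      (fun _ => h.hasDerivWithinAt)
      ((intervalIntegrable_iff_integrableOn_Ioc_of_le zero_le_one).2 h.integrableOn_rightDeriv),
    h.envelope_one, h.envelope_zero, sub_zero]

/-- The affine function of slope `c` through the graph of `f` at a minimizer `s` of `f t - c t` also
minorizes the envelope and touches it at `s`, which therefore separates the slopes below and above
`c`. -/
theorem rightDeriv_of_isMinOn (h : IsUnitProfile f) {c s : ℝ} (hs : s ∈ Icc (0 : ℝ) 1)
    (hmin : ∀ t ∈ Icc (0 : ℝ) 1, f s - c * s ≤ f t - c * t) :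
    (∀ u, 0 < u → u < s → derivWithin (convexEnvelope (Icc 0 1) f) (Ioi u) u ≤ c) ∧
      ∀ u, s < u → u < 1 → c ≤ derivWithin (convexEnvelope (Icc 0 1) f) (Ioi u) u := by
  have hle : ∀ t ∈ Icc (0 : ℝ) 1, c * t + (f s - c * s) ≤ convexEnvelope (Icc 0 1) f t :=
    fun t ht => affine_le_envelope (fun t ht => by linarith [hmin t ht]) ht
  have hs' := h.envelope_le hs
  constructor
  · intro u hu hus
    have h1 := h.rightDeriv_le hu hus hs.2
    have h2 := hle u ⟨hu.le, hus.le.trans hs.2⟩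
    exact le_of_mul_le_mul_right (by linarith) (sub_pos.2 hus)
  · intro u hus hu
    have h1 := h.le_rightDeriv hs.1 hus hu
    have h2 := hle u ⟨hs.1.trans hus.le, hu.le⟩
    exact le_of_mul_le_mul_right (by linarith) (sub_pos.2 hus)

end IsUnitProfile

/-! ### The weighting distribution in terms of probabilities -/

/-- The left-continuous distribution function `(Φ([0, t)) + l t) / (1 + l)` of the normalized
weighting measure `Φ + l dz` of the mean-WVaR objective. -/
noncomputable def weightCdf (Φ : Measure ℝ) (l t : ℝ) : ℝ := (Φ.real (Ico 0 t) + l * t) / (1 + l)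

theorem exists_lt_measureReal_Ico (Φ : Measure ℝ) [IsProbabilityMeasure Φ] {v t : ℝ}
    (h : v < Φ.real (Ico 0 t)) : ∃ t' < t, v < Φ.real (Ico 0 t') := by
  have hmono : Monotone fun n : ℕ => Ico 0 (t - 1 / ((n : ℝ) + 1)) := by
    intro m n hmn
    refine Ico_subset_Ico_right ?_
    have := Nat.one_div_le_one_div (α := ℝ) hmn
    linarith
  have hunion : ⋃ n : ℕ, Ico 0 (t - 1 / ((n : ℝ) + 1)) = Ico 0 t := by
    ext s
    simp only [mem_iUnion, mem_Ico]
    constructor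
    · rintro ⟨n, h1, h2⟩
      have : (0 : ℝ) < 1 / ((n : ℝ) + 1) := by positivity
      exact ⟨h1, by linarith⟩
    · rintro ⟨h1, h2⟩
      obtain ⟨n, hn⟩ := exists_nat_one_div_lt (sub_pos.2 h2)
      exact ⟨n, h1, by linarith⟩
  have ht := tendsto_measure_iUnion_atTop (μ := Φ) hmono
  rw [hunion] at ht
  have ht' := (ENNReal.tendsto_toReal (measure_ne_top Φ (Ico 0 t))).comp ht
  obtain ⟨n, hn⟩ := (ht'.eventually (lt_mem_nhds h)).exists
  exact ⟨_, sub_lt_self _ (by positivity), hn⟩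

theorem monotone_measureReal_Ico (Φ : Measure ℝ) [IsProbabilityMeasure Φ] :
    Monotone fun t => Φ.real (Ico 0 t) := fun _ _ h =>
  measureReal_mono (Ico_subset_Ico_right h)

theorem monotone_weightCdf (Φ : Measure ℝ) [IsProbabilityMeasure Φ] {l : ℝ} (hl : 0 ≤ l) :
    Monotone (weightCdf Φ l) := fun a b h => by
  have := monotone_measureReal_Ico Φ h
  simp only at this
  unfold weightCdf
  gcongr

theorem lowerSemicontinuous_weightCdf (Φ : Measure ℝ) [IsProbabilityMeasure Φ] {l : ℝ}
    (hl : 0 ≤ l) : LowerSemicontinuous (weightCdf Φ l) := by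
  have h1 : LowerSemicontinuous fun t => Φ.real (Ico 0 t) := by
    intro t v hv
    obtain ⟨t', ht', hv'⟩ := exists_lt_measureReal_Ico Φ hv
    filter_upwards [lt_mem_nhds ht'] with u hu
    exact hv'.trans_le (monotone_measureReal_Ico Φ hu.le)
  have h2 : LowerSemicontinuous fun t : ℝ => l * t :=
    Continuous.lowerSemicontinuous (by fun_prop)
  have h3 : Monotone fun u : ℝ => u / (1 + l) := fun a b hab => by
    simp only
    gcongr
  exact (show Continuous fun u : ℝ => u / (1 + l) by fun_prop).comp_lowerSemicontinuous
    (h1.add h2) h3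

theorem weightCdf_zero (Φ : Measure ℝ) (l : ℝ) : weightCdf Φ l 0 = 0 := by simp [weightCdf]

theorem weightCdf_le_one (Φ : Measure ℝ) [IsProbabilityMeasure Φ] {l t : ℝ} (hl : 0 ≤ l)
    (ht : t ≤ 1) : weightCdf Φ l t ≤ 1 := by
  rw [weightCdf, div_le_one (by positivity)]
  have : Φ.real (Ico 0 t) ≤ 1 := measureReal_le_one
  nlinarith

theorem weightCdf_nonneg (Φ : Measure ℝ) [IsProbabilityMeasure Φ] {l t : ℝ} (hl : 0 ≤ l)
    (ht : 0 ≤ t) : 0 ≤ weightCdf Φ l t := by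
  rw [← weightCdf_zero Φ l]
  exact monotone_weightCdf Φ hl ht

namespace IsRegularDensity

variable {Ω : Type*} [MeasurableSpace Ω] {P : Measure Ω} {ξ : Ω → ℝ} {Φ : Measure ℝ} {l : ℝ}

theorem measurable_deltaRight : Measurable (deltaRight P ξ Φ l) :=
  measurable_derivWithin_Ioi _

variable [IsProbabilityMeasure P]

theorem phiLeft_wFun (h : IsRegularDensity P ξ) {t : ℝ} (ht : t ∈ Icc (0 : ℝ) 1) :
    phiLeft P ξ Φ l (wFun P ξ t) = weightCdf Φ l t := by
  rw [phiLeft, h.wInv_wFun ht, weightCdf]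

variable [IsProbabilityMeasure Φ]

theorem isUnitProfile_phiLeft (h : IsRegularDensity P ξ) (hΦ : Φ (Icc 0 1)ᶜ = 0)
    (hΦ_one : Φ {1} = 0) (hl : 0 ≤ l) : IsUnitProfile (phiLeft P ξ Φ l) where
  zero := by
    have h0 := h.phiLeft_wFun (Φ := Φ) (l := l) (left_mem_Icc.2 zero_le_one)
    rwa [wFun_zero, weightCdf_zero] at h0
  nonneg s hs := by
    obtain ⟨t, ht, rfl⟩ := h.exists_wFun_eq hs
    rw [h.phiLeft_wFun ht]
    exact weightCdf_nonneg Φ hl ht.1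
  le_one s hs := by
    obtain ⟨t, ht, rfl⟩ := h.exists_wFun_eq hs
    rw [h.phiLeft_wFun ht]
    exact weightCdf_le_one Φ hl ht.2
  left_limit ε hε := by
    have hmass : Φ.real (Ico 0 1) = 1 := by
      have h1 : Ico (0 : ℝ) 1 =ᵐ[Φ] univ := by
        rw [ae_eq_univ]
        refine measure_mono_null (t := (Icc (0 : ℝ) 1)ᶜ ∪ {1}) (fun s hs => ?_)
          (measure_union_null hΦ hΦ_one)
        by_contra hcon
        simp only [mem_union, mem_compl_iff, mem_Icc, mem_singleton_iff, not_or, not_not] at hcon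
        exact hs ⟨hcon.1.1, lt_of_le_of_ne hcon.1.2 hcon.2⟩
      rw [measureReal_congr h1, probReal_univ]
    have hone : weightCdf Φ l 1 = 1 := by
      rw [weightCdf, hmass, mul_one, div_self (by positivity)]
    have hev := lowerSemicontinuous_weightCdf Φ hl 1 (1 - ε) (show 1 - ε < weightCdf Φ l 1 by
      rw [hone]; linarith)
    obtain ⟨b, hb, hb'⟩ := exists_Ioc_subset_of_mem_nhds hev ⟨0, zero_lt_one⟩
    obtain ⟨t₀, ht₀, ht₀1⟩ := exists_between (max_lt hb zero_lt_one)
    have ht₀' : t₀ ∈ Icc (0 : ℝ) 1 := ⟨(le_max_right _ _).trans ht₀.le, ht₀1.le⟩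
    refine ⟨wFun P ξ t₀, ⟨(h.wFun_mem ht₀').1, ?_⟩, fun s hs => ?_⟩
    · rw [← h.wFun_one]
      exact h.strictMonoOn_wFun ht₀' (right_mem_Icc.2 zero_le_one) ht₀1
    · obtain ⟨t, ht, rfl⟩ := h.exists_wFun_eq ⟨(h.wFun_mem ht₀').1.trans hs.1, hs.2⟩
      rw [h.phiLeft_wFun ht]
      have htt : t₀ ≤ t := (h.strictMonoOn_wFun.le_iff_le ht₀' ht).1 hs.1
      exact (show 1 - ε < _ from hb' ⟨(le_max_left _ _).trans_lt ht₀, ht₀1.le⟩).le.trans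
        (monotone_weightCdf Φ hl htt)

theorem exists_isMinOn_phiLeft (h : IsRegularDensity P ξ) (hl : 0 ≤ l) (c : ℝ) :
    ∃ t ∈ Icc (0 : ℝ) 1, ∀ u ∈ Icc (0 : ℝ) 1,
      weightCdf Φ l t - c * wFun P ξ t ≤ weightCdf Φ l u - c * wFun P ξ u := by
  have hlsc : LowerSemicontinuousOn (fun t => weightCdf Φ l t + -(c * wFun P ξ t)) (Icc 0 1) :=
    ((lowerSemicontinuous_weightCdf Φ hl).lowerSemicontinuousOn _).add
      (continuousOn_const.mul h.continuousOn_wFun).neg.lowerSemicontinuousOn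
  obtain ⟨t, ht, hmin⟩ := hlsc.exists_isMinOn (nonempty_Icc.2 zero_le_one) isCompact_Icc
  exact ⟨t, ht, fun u hu => by simpa only [sub_eq_add_neg] using isMinOn_iff.1 hmin u hu⟩

/-! ### The likelihood variable `δ'(w(1 - F_ξ(ξ)))` -/

theorem rankVar_mem (h : IsRegularDensity P ξ) (ω : Ω) : rankVar P ξ ω ∈ Ioo (0 : ℝ) 1 := by
  have hv := h.survRank_mem ω
  have hv' : survRank P ξ ω ∈ Icc (0 : ℝ) 1 := ⟨hv.1.le, hv.2.le⟩
  have h1 := h.strictMonoOn_wFun (left_mem_Icc.2 zero_le_one) hv' hv.1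
  have h2 := h.strictMonoOn_wFun hv' (right_mem_Icc.2 zero_le_one) hv.2
  rw [wFun_zero] at h1
  rw [h.wFun_one] at h2
  exact ⟨h1, h2⟩

theorem rankVar_lt_iff (h : IsRegularDensity P ξ) {t : ℝ} (ht : t ∈ Icc (0 : ℝ) 1) (ω : Ω) :
    rankVar P ξ ω < wFun P ξ t ↔ survRank P ξ ω < t :=
  h.strictMonoOn_wFun.lt_iff_lt (Ioo_subset_Icc_self (h.survRank_mem ω)) ht

/-- The rank variable is a measurable function of the state price density. -/
theorem exists_measurable_rankVar (h : IsRegularDensity P ξ) :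
    ∃ g : ℝ → ℝ, Measurable g ∧ ∀ ω, rankVar P ξ ω = g (ξ ω) := by
  refine ⟨fun y => wFun P ξ (max 0 (min (1 - distFun P (fun ω' => (ξ ω' : EReal)) y) 1)),
    h.measurable_wFun.comp (measurable_const.sub (monotone_distFun P _).measurable), fun ω => ?_⟩
  have hv := h.survRank_mem ω
  change wFun P ξ (survRank P ξ ω) = wFun P ξ (max 0 (min (survRank P ξ ω) 1))
  rw [min_eq_left hv.2.le, max_eq_right hv.1.le]

theorem measurable_rankVar (h : IsRegularDensity P ξ) : Measurable (rankVar P ξ) := by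
  obtain ⟨g, hg, hgξ⟩ := h.exists_measurable_rankVar
  rw [funext hgξ]
  exact hg.comp h.measurable

theorem deltaRight_rankVar_nonneg (h : IsRegularDensity P ξ) (hΦ : Φ (Icc 0 1)ᶜ = 0)
    (hΦ_one : Φ {1} = 0) (hl : 0 ≤ l) (ω : Ω) : 0 ≤ deltaRight P ξ Φ l (rankVar P ξ ω) :=
  (h.isUnitProfile_phiLeft hΦ hΦ_one hl).rightDeriv_nonneg (h.rankVar_mem ω)

theorem measure_rankVar_eq (h : IsRegularDensity P ξ) {s : ℝ} (hs : s ∈ Icc (0 : ℝ) 1) :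
    P {ω | rankVar P ξ ω = s} = 0 := by
  obtain ⟨t, ht, rfl⟩ := h.exists_wFun_eq hs
  refine measure_mono_null (fun ω hω => ?_) (h.measure_survRank_eq t)
  exact h.strictMonoOn_wFun.injOn (Ioo_subset_Icc_self (h.survRank_mem ω)) ht hω

/-- Under the measure with density `ξ` the rank variable is uniformly distributed. -/
theorem map_rankVar (h : IsRegularDensity P ξ) :
    (P.withDensity fun ω => ENNReal.ofReal (ξ ω)).map (rankVar P ξ) =
      ENNReal.ofReal (∫ ω, ξ ω ∂P) • volume.restrict (Icc (0 : ℝ) 1) := by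
  have hset : ∀ {S : Set Ω}, MeasurableSet S →
      (P.withDensity fun ω => ENNReal.ofReal (ξ ω)) S = ENNReal.ofReal (∫ ω in S, ξ ω ∂P) := by
    intro S hS
    rw [withDensity_apply _ hS, ofReal_integral_eq_lintegral_ofReal h.integrable.integrableOn
      (Filter.Eventually.of_forall fun ω => (h.pos ω).le)]
  have huniv := hset MeasurableSet.univ
  rw [Measure.restrict_univ] at huniv
  have : IsFiniteMeasure (P.withDensity fun ω => ENNReal.ofReal (ξ ω)) :=
    ⟨huniv ▸ ENNReal.ofReal_lt_top⟩
  refine map_eq_smul_volume_of_measure_lt h.measurable_rankVar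
    (fun ω => Ioo_subset_Icc_self (h.rankVar_mem ω)) _ ENNReal.ofReal_ne_top huniv fun s hs => ?_
  obtain ⟨t, ht, rfl⟩ := h.exists_wFun_eq (Ioo_subset_Icc_self hs)
  simp only [h.rankVar_lt_iff ht]
  rw [hset (S := {ω | survRank P ξ ω < t}) (h.measurable_survRank measurableSet_Iio), h.setIntegral_survRank_lt ht.2,
    ENNReal.ofReal_mul h.integral_pos.le]

theorem integrable_mul_deltaRight (h : IsRegularDensity P ξ) (hΦ : Φ (Icc 0 1)ᶜ = 0)
    (hΦ_one : Φ {1} = 0) (hl : 0 ≤ l) :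
    Integrable (fun ω => ξ ω * deltaRight P ξ Φ l (rankVar P ξ ω)) P ∧
      ∫ ω, ξ ω * deltaRight P ξ Φ l (rankVar P ξ ω) ∂P = ∫ ω, ξ ω ∂P := by
  have hprof := h.isUnitProfile_phiLeft hΦ hΦ_one hl
  have hmeas : Measurable fun ω => ENNReal.ofReal (ξ ω) := h.measurable.ennreal_ofReal
  have hfin : ∀ᵐ ω ∂P, ENNReal.ofReal (ξ ω) < ⊤ :=
    Filter.Eventually.of_forall fun _ => ENNReal.ofReal_lt_top
  have hsmul : ∀ ω, (ENNReal.ofReal (ξ ω)).toReal • deltaRight P ξ Φ l (rankVar P ξ ω) =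
      ξ ω * deltaRight P ξ Φ l (rankVar P ξ ω) := fun ω => by
    rw [ENNReal.toReal_ofReal (h.pos ω).le, smul_eq_mul]
  have hint : IntegrableOn (deltaRight P ξ Φ l) (Icc 0 1) := by
    rw [integrableOn_Icc_iff_integrableOn_Ioc]
    exact hprof.integrableOn_rightDeriv
  constructor
  · have h1 : Integrable (deltaRight P ξ Φ l)
        ((P.withDensity fun ω => ENNReal.ofReal (ξ ω)).map (rankVar P ξ)) := by
      rw [h.map_rankVar]
      exact hint.smul_measure ENNReal.ofReal_ne_top
    have h2 := h1.comp_measurable h.measurable_rankVar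
    rw [integrable_withDensity_iff_integrable_smul' hmeas hfin] at h2
    simpa only [Function.comp_apply, hsmul] using h2
  · have h1 := integral_map (μ := P.withDensity fun ω => ENNReal.ofReal (ξ ω))
      h.measurable_rankVar.aemeasurable
      (measurable_deltaRight (P := P) (ξ := ξ) (Φ := Φ) (l := l)).aestronglyMeasurable
    rw [h.map_rankVar, integral_smul_measure, ENNReal.toReal_ofReal h.integral_pos.le,
      show ∫ u in Icc (0 : ℝ) 1, deltaRight P ξ Φ l u = 1 from hprof.integral_rightDeriv,
      smul_eq_mul, mul_one, integral_withDensity_eq_integral_toReal_smul hmeas hfin] at h1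
    simpa only [hsmul] using h1.symm

/-- The lower level sets of the likelihood variable are lower level sets of the rank. -/
theorem rankVar_lt_ae_eq (h : IsRegularDensity P ξ) (hΦ : Φ (Icc 0 1)ᶜ = 0)
    (hΦ_one : Φ {1} = 0) (hl : 0 ≤ l) {c t : ℝ}
    (hc : P {ω | deltaRight P ξ Φ l (rankVar P ξ ω) = c} = 0) (ht : t ∈ Icc (0 : ℝ) 1)
    (hmin : ∀ u ∈ Icc (0 : ℝ) 1,
      weightCdf Φ l t - c * wFun P ξ t ≤ weightCdf Φ l u - c * wFun P ξ u) :
    {ω | survRank P ξ ω < t} =ᵐ[P] {ω | deltaRight P ξ Φ l (rankVar P ξ ω) < c} := by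
  have hs := h.wFun_mem ht
  obtain ⟨h1, h2⟩ := (h.isUnitProfile_phiLeft (Φ := Φ) hΦ hΦ_one hl).rightDeriv_of_isMinOn
    (c := c) hs (by
      intro s' hs'
      obtain ⟨u, hu, rfl⟩ := h.exists_wFun_eq hs'
      rw [h.phiLeft_wFun ht, h.phiLeft_wFun hu]
      exact hmin u hu)
  have hne1 : ∀ᵐ ω ∂P, deltaRight P ξ Φ l (rankVar P ξ ω) ≠ c := by
    rw [ae_iff]; simpa using hc
  have hne2 : ∀ᵐ ω ∂P, rankVar P ξ ω ≠ wFun P ξ t := by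
    rw [ae_iff]; simpa using h.measure_rankVar_eq hs
  filter_upwards [hne1, hne2] with ω h3 h4
  refine propext ?_
  change survRank P ξ ω < t ↔ deltaRight P ξ Φ l (rankVar P ξ ω) < c
  rw [← h.rankVar_lt_iff ht]
  have hmem := h.rankVar_mem ω
  constructor
  · intro h5
    exact lt_of_le_of_ne (h1 _ hmem.1 h5) h3
  · intro h5
    refine lt_of_le_of_ne (not_lt.1 fun h6 => ?_) h4
    exact (h2 _ h6 hmem.2).not_gt h5

/-- For every multiplier `c` that is not an atom of the likelihood variable `δ'(w(1 - F_ξ(ξ)))`,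
the event that this variable is below `c` is, up to null sets, the only event that minimizes the
weighted probability minus `c` times the budget share. -/
theorem weightCdf_sub_le (h : IsRegularDensity P ξ) (hΦ : Φ (Icc 0 1)ᶜ = 0)
    (hΦ_one : Φ {1} = 0) (hl : 0 ≤ l) {c : ℝ} (hc0 : 0 < c)
    (hc : P {ω | deltaRight P ξ Φ l (rankVar P ξ ω) = c} = 0) {A : Set Ω} (hA : MeasurableSet A) :
    weightCdf Φ l (P.real {ω | deltaRight P ξ Φ l (rankVar P ξ ω) < c}) -
        c / (∫ ω, ξ ω ∂P) * ∫ ω in {ω | deltaRight P ξ Φ l (rankVar P ξ ω) < c}, ξ ω ∂P ≤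
      weightCdf Φ l (P.real A) - c / (∫ ω, ξ ω ∂P) * ∫ ω in A, ξ ω ∂P ∧
    (weightCdf Φ l (P.real {ω | deltaRight P ξ Φ l (rankVar P ξ ω) < c}) -
        c / (∫ ω, ξ ω ∂P) * ∫ ω in {ω | deltaRight P ξ Φ l (rankVar P ξ ω) < c}, ξ ω ∂P =
      weightCdf Φ l (P.real A) - c / (∫ ω, ξ ω ∂P) * ∫ ω in A, ξ ω ∂P →
      A =ᵐ[P] {ω | deltaRight P ξ Φ l (rankVar P ξ ω) < c}) := by
  have hE := h.integral_pos
  obtain ⟨t, ht, hmin⟩ := h.exists_isMinOn_phiLeft (Φ := Φ) hl c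
  have hae := h.rankVar_lt_ae_eq hΦ hΦ_one hl hc ht hmin
  have hcE : c / (∫ ω, ξ ω ∂P) * (∫ ω, ξ ω ∂P) = c := div_mul_cancel₀ _ hE.ne'
  rw [← measureReal_congr hae, ← setIntegral_congr_set hae, h.measureReal_survRank_lt ht,
    h.setIntegral_survRank_lt ht.2, ← mul_assoc, hcE]
  have hp : P.real A ∈ Icc (0 : ℝ) 1 := ⟨measureReal_nonneg, measureReal_le_one⟩
  obtain ⟨hle, heq⟩ := h.setIntegral_le_wFun hA
  have hle' := mul_le_mul_of_nonneg_left hle (div_pos hc0 hE).le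
  rw [← mul_assoc, hcE] at hle'
  have hminp := hmin _ hp
  refine ⟨by linarith, fun heq' => ?_⟩
  have h1 : c / (∫ ω, ξ ω ∂P) * ∫ ω in A, ξ ω ∂P =
      c / (∫ ω, ξ ω ∂P) * ((∫ ω, ξ ω ∂P) * wFun P ξ (P.real A)) := by
    rw [← mul_assoc _ _ (wFun P ξ (P.real A)), hcE]
    linarith
  refine (heq (mul_left_cancel₀ (div_pos hc0 hE).ne' h1)).trans
    (h.rankVar_lt_ae_eq hΦ hΦ_one hl hc hp fun u hu => ?_)
  linarith [hmin u hu]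

end IsRegularDensity

/-! ### Layer-cake formulas -/

theorem toENNReal_eq_volume (v : EReal) :
    v.toENNReal = volume (Ioi (0 : ℝ) ∩ {y : ℝ | (y : EReal) ≤ v}) := by
  induction v with
  | bot =>
    have : Ioi (0 : ℝ) ∩ {y : ℝ | (y : EReal) ≤ ⊥} = ∅ := by ext y; simp
    rw [this]; simp
  | top =>
    have : Ioi (0 : ℝ) ∩ {y : ℝ | (y : EReal) ≤ ⊤} = Ioi 0 := by ext y; simp
    rw [this]; simp
  | coe a =>
    have : Ioi (0 : ℝ) ∩ {y : ℝ | (y : EReal) ≤ a} = Ioc 0 a := by ext y; simp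
    rw [this]; simp

theorem toENNReal_neg_eq_volume (v : EReal) :
    (-v).toENNReal = volume (Iio (0 : ℝ) ∩ {y : ℝ | v < (y : EReal)}) := by
  induction v with
  | bot =>
    have : Iio (0 : ℝ) ∩ {y : ℝ | ⊥ < (y : EReal)} = Iio 0 := by ext y; simp
    rw [this]; simp
  | top =>
    have : Iio (0 : ℝ) ∩ {y : ℝ | ⊤ < (y : EReal)} = ∅ := by ext y; simp
    rw [this]; simp
  | coe a =>
    have : Iio (0 : ℝ) ∩ {y : ℝ | (a : EReal) < y} = Ioo a 0 := by
      ext y; simp [and_comm]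
    rw [this, ← EReal.coe_neg]; simp

theorem lintegral_measure_inter {α : Type*} [MeasurableSpace α] (m : Measure α) [SFinite m]
    {J : Set ℝ} {S : Set (α × ℝ)} (hS : MeasurableSet S) :
    ∫⁻ a, volume (J ∩ {y | (a, y) ∈ S}) ∂m = ∫⁻ y in J, m {a | (a, y) ∈ S} := by
  have h1 : ∀ a, volume (J ∩ {y | (a, y) ∈ S}) =
      ∫⁻ y in J, S.indicator (fun _ => (1 : ENNReal)) (a, y) := fun a => by
    have hm : MeasurableSet {y | (a, y) ∈ S} := measurable_prodMk_left hS
    rw [inter_comm, ← Measure.restrict_apply hm, ← lintegral_indicator_one hm]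
    rfl
  have h2 : ∀ y, m {a | (a, y) ∈ S} = ∫⁻ a, S.indicator (fun _ => (1 : ENNReal)) (a, y) ∂m :=
    fun y => by
    have hm : MeasurableSet {a | (a, y) ∈ S} := measurable_prodMk_right hS
    rw [← lintegral_indicator_one hm]
    rfl
  simp only [h1, h2]
  exact lintegral_lintegral_swap (f := fun a y => S.indicator (fun _ => (1 : ENNReal)) (a, y))
    (measurable_const.indicator hS).aemeasurable

theorem extIntegral_eq {α : Type*} [MeasurableSpace α] (m : Measure α) [SFinite m]
    {f : α → EReal} (hf : Measurable f) :
    extIntegral m f = ((∫⁻ y : ℝ in Ioi 0, m {a | (y : EReal) ≤ f a} : ENNReal) : EReal) -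
      ((∫⁻ y : ℝ in Iio 0, m {a | f a < (y : EReal)} : ENNReal) : EReal) := by
  rw [extIntegral]
  simp only [toENNReal_eq_volume (f _), toENNReal_neg_eq_volume]
  have hsnd : Measurable fun z : α × ℝ => (z.2 : EReal) := measurable_snd.coe_real_ereal
  have hgain : ∫⁻ a, volume (Ioi (0 : ℝ) ∩ {y : ℝ | (y : EReal) ≤ f a}) ∂m =
      ∫⁻ y : ℝ in Ioi 0, m {a | (y : EReal) ≤ f a} :=
    lintegral_measure_inter m (measurableSet_le hsnd (hf.comp measurable_fst))
  have hloss : ∫⁻ a, volume (Iio (0 : ℝ) ∩ {y : ℝ | f a < (y : EReal)}) ∂m =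
      ∫⁻ y : ℝ in Iio 0, m {a | f a < (y : EReal)} :=
    lintegral_measure_inter m (measurableSet_lt (hf.comp measurable_fst) hsnd)
  rw [hgain, hloss]

theorem measure_le_eq {α : Type*} [MeasurableSpace α] (m : Measure α) [IsProbabilityMeasure m]
    {f : α → EReal} (hf : Measurable f) (y : ℝ) :
    m {a | (y : EReal) ≤ f a} = ENNReal.ofReal (1 - m.real {a | f a < (y : EReal)}) := by
  have hm : MeasurableSet {a | f a < (y : EReal)} := measurableSet_lt hf measurable_const
  rw [← probReal_compl_eq_one_sub hm, ofReal_measureReal]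
  congr 1
  ext a
  simp

/-- A probability measure on `[0, 1)` evaluates the lower level sets of a quantile function through
the intervals `[0, P(R < y))`. -/
theorem measureReal_quantile_lt {Ω : Type*} [MeasurableSpace Ω] {P : Measure Ω}
    [IsProbabilityMeasure P] {Φ : Measure ℝ} (hΦ : Φ (Icc 0 1)ᶜ = 0)
    (hΦ_one : Φ {1} = 0) {R : Ω → EReal} (y : ℝ) :
    Φ.real {z | quantile P R z < (y : EReal)} = Φ.real (Ico 0 (P.real {ω | R ω < (y : EReal)})) := by
  refine measureReal_congr ?_
  have h1 : ∀ᵐ z ∂Φ, z ∈ Icc (0 : ℝ) 1 := by rw [ae_iff]; exact hΦ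
  have h2 : ∀ᵐ z ∂Φ, z ≠ 1 := by rw [ae_iff]; simpa using hΦ_one
  filter_upwards [h1, h2] with z hz hz1
  refine propext ?_
  change quantile P R z < (y : EReal) ↔ z ∈ Ico 0 (P.real {ω | R ω < (y : EReal)})
  rw [quantile_lt_iff (lt_of_le_of_ne hz.2 hz1), mem_Ico, and_iff_right hz.1]

/-! ### The objective as an integral over levels of the log-return -/

/-- The part of the objective that comes from positive levels `y` of the log-return, in terms of
`p y = P(R < y)`. -/
noncomputable def gainPart (Φ : Measure ℝ) (l : ℝ) (p : ℝ → ℝ) : ENNReal :=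
  ∫⁻ y in Ioi 0, ENNReal.ofReal ((1 + l) * (1 - weightCdf Φ l (p y)))

/-- The part of the objective that comes from negative levels `y` of the log-return, in terms of
`p y = P(R < y)`. -/
noncomputable def lossPart (Φ : Measure ℝ) (l : ℝ) (p : ℝ → ℝ) : ENNReal :=
  ∫⁻ y in Iio 0, ENNReal.ofReal ((1 + l) * weightCdf Φ l (p y))

/-- Weighted sums of differences, under the convention that `∞ - ∞` is `-∞`. -/
theorem coe_mul_sub_add_sub {l : ℝ} (hl : 0 ≤ l) (a b a' b' : ENNReal) :
    (b' + ENNReal.ofReal l * b ≠ ⊤ → (l : EReal) * ((a : EReal) - b) - -((a' : EReal) - b') =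
      ((a' + ENNReal.ofReal l * a : ENNReal) : EReal) - ((b' + ENNReal.ofReal l * b : ENNReal) :
        EReal)) ∧
    (b' + ENNReal.ofReal l * b = ⊤ →
      (l : EReal) * ((a : EReal) - b) - -((a' : EReal) - b') = ⊥) := by
  have hneg : ∀ z : EReal, (l : EReal) * ((a : EReal) - b) - -z = (l : EReal) * ((a : EReal) - b) + z :=
    fun z => by rw [sub_eq_add_neg, neg_neg]
  rw [hneg]
  rcases hl.eq_or_lt with rfl | hl0
  · simp only [EReal.coe_zero, zero_mul, zero_add, ENNReal.ofReal_zero, add_zero, ne_eq]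
    refine ⟨fun _ => trivial, fun hb => ?_⟩
    rw [hb, EReal.coe_ennreal_top, EReal.sub_top]
  · have hl1 : ENNReal.ofReal l ≠ 0 := by simpa using hl0
    constructor
    · intro hfin
      obtain ⟨hb', hlb⟩ := ENNReal.add_ne_top.1 hfin
      have hb : b ≠ ⊤ := fun hb => hlb (by rw [hb, ENNReal.mul_top hl1])
      lift b to NNReal using hb
      lift b' to NNReal using hb'
      have hfin' : ((b' + ENNReal.ofReal l * b : ENNReal) : EReal) = ((b' + l * b : ℝ) : EReal) := by
        rw [EReal.coe_ennreal_add, EReal.coe_ennreal_mul, EReal.coe_ennreal_ofReal, max_eq_left hl]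
        rfl
      rw [hfin']
      induction a with
      | top =>
        rw [ENNReal.mul_top hl1, add_top]
        have h1 : (⊤ : EReal) - ((b : ENNReal) : EReal) = ⊤ := EReal.top_sub_coe b
        rw [EReal.coe_ennreal_top, h1, EReal.coe_mul_top_of_pos hl0]
        have h2 : (a' : EReal) - ((b' : ENNReal) : EReal) ≠ ⊥ := by
          induction a' with
          | top =>
            rw [EReal.coe_ennreal_top]
            exact (EReal.top_sub_coe (b' : ℝ)).trans_ne (by simp)
          | coe a' =>
            exact (EReal.coe_sub (a' : ℝ) (b' : ℝ)).symm.trans_ne (EReal.coe_ne_bot _)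
        rw [EReal.top_add_of_ne_bot h2, EReal.top_sub_coe]
      | coe a =>
        have h1 : ((a : ENNReal) : EReal) - ((b : ENNReal) : EReal) = ((a - b : ℝ) : EReal) :=
          (EReal.coe_sub _ _).symm
        rw [h1]
        induction a' with
        | top =>
          rw [top_add, EReal.coe_ennreal_top, EReal.top_sub_coe]
          have h2 : (⊤ : EReal) - ((b' : ENNReal) : EReal) = ⊤ := EReal.top_sub_coe b'
          rw [h2, ← EReal.coe_mul, EReal.coe_add_top]
        | coe a' =>
          have h2 : ((a' : ENNReal) : EReal) - ((b' : ENNReal) : EReal) = ((a' - b' : ℝ) : EReal) :=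
            (EReal.coe_sub _ _).symm
          have h3 : (((a' : ENNReal) + ENNReal.ofReal l * a : ENNReal) : EReal) =
              ((a' + l * a : ℝ) : EReal) := by
            rw [EReal.coe_ennreal_add, EReal.coe_ennreal_mul, EReal.coe_ennreal_ofReal,
              max_eq_left hl]
            rfl
          rw [h2, h3, ← EReal.coe_mul, ← EReal.coe_add, ← EReal.coe_sub]
          congr 1
          ring
    · intro htop
      rcases ENNReal.add_eq_top.1 htop with hb | hb
      · rw [hb, EReal.coe_ennreal_top, EReal.sub_top, EReal.add_bot]
      · have hb' : b = ⊤ := by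
          by_contra hcon
          exact ENNReal.mul_ne_top ENNReal.ofReal_ne_top hcon hb
        rw [hb', EReal.coe_ennreal_top, EReal.sub_top, EReal.coe_mul_bot_of_pos hl0, EReal.bot_add]

theorem sub_le_sub_of_add_le_add {a b c d : ENNReal} (hb : b ≠ ⊤) (hd : d ≠ ⊤)
    (h : a + d ≤ c + b) : (a : EReal) - b ≤ (c : EReal) - d := by
  lift b to NNReal using hb
  lift d to NNReal using hd
  induction c with
  | top =>
    have h1 : (⊤ : EReal) - ((d : ENNReal) : EReal) = ⊤ := EReal.top_sub_coe d
    rw [EReal.coe_ennreal_top, h1]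
    exact le_top
  | coe c =>
    have ha : a ≠ ⊤ := fun ha => by rw [ha, top_add] at h; simp at h
    lift a to NNReal using ha
    have h' : (a : ℝ) + d ≤ c + b := by exact_mod_cast h
    have h1 : ((a : ℝ) : EReal) - ((b : ℝ) : EReal) ≤ ((c : ℝ) : EReal) - ((d : ℝ) : EReal) := by
      rw [← EReal.coe_sub, ← EReal.coe_sub, EReal.coe_le_coe_iff]
      linarith
    exact h1

theorem add_le_add_of_sub_le_sub {a b c d : ENNReal} (hb : b ≠ ⊤) (hc : c ≠ ⊤) (hd : d ≠ ⊤)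
    (h : (a : EReal) - b ≤ (c : EReal) - d) : a + d ≤ c + b := by
  lift b to NNReal using hb
  lift d to NNReal using hd
  lift c to NNReal using hc
  have h2 : ((c : ENNReal) : EReal) - ((d : ENNReal) : EReal) = ((c - d : ℝ) : EReal) :=
    (EReal.coe_sub _ _).symm
  rw [h2] at h
  induction a with
  | top =>
    have h1 : (⊤ : EReal) - ((b : ENNReal) : EReal) = ⊤ := EReal.top_sub_coe b
    rw [EReal.coe_ennreal_top, h1, top_le_iff] at h
    exact absurd h (EReal.coe_ne_top _)
  | coe a =>
    have h1 : ((a : ENNReal) : EReal) - ((b : ENNReal) : EReal) = ((a - b : ℝ) : EReal) :=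
      (EReal.coe_sub _ _).symm
    rw [h1, EReal.coe_le_coe_iff] at h
    have : (a : ℝ) + d ≤ c + b := by linarith
    exact_mod_cast this

theorem meanWVaR_eq {Ω : Type*} [MeasurableSpace Ω] {P : Measure Ω} [IsProbabilityMeasure P]
    {Φ : Measure ℝ} [IsProbabilityMeasure Φ] (hΦ : Φ (Icc 0 1)ᶜ = 0) (hΦ_one : Φ {1} = 0)
    {l : ℝ} (hl : 0 ≤ l) {R : Ω → EReal} (hR : Measurable R) {p : ℝ → ℝ}
    (hp : ∀ y : ℝ, P.real {ω | R ω < (y : EReal)} = p y) :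
    (lossPart Φ l p ≠ ⊤ →
      meanWVaR P Φ l R = (gainPart Φ l p : EReal) - (lossPart Φ l p : EReal)) ∧
    (lossPart Φ l p = ⊤ → meanWVaR P Φ l R = ⊥) := by
  have hres : Φ.restrict (Icc 0 1) = Φ :=
    Measure.restrict_eq_self_of_ae_mem (by rw [ae_iff]; exact hΦ)
  have hq : Measurable (quantile P R) := (monotone_quantile P R).measurable
  have hpmono : Monotone p := fun a b hab => by
    rw [← hp, ← hp]
    exact measureReal_mono fun ω hω => lt_of_lt_of_le hω (EReal.coe_le_coe_iff.2 hab)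
  have hp0 : ∀ y, 0 ≤ p y := fun y => hp y ▸ measureReal_nonneg
  have hp1 : ∀ y, p y ≤ 1 := fun y => hp y ▸ measureReal_le_one
  have hpΦ : Measurable fun y => Φ.real (Ico 0 (p y)) :=
    ((monotone_measureReal_Ico Φ).comp hpmono).measurable
  have h1l : (1 + l) ≠ 0 := by positivity
  have hgain : gainPart Φ l p = (∫⁻ y in Ioi 0, ENNReal.ofReal (1 - Φ.real (Ico 0 (p y)))) +
      ENNReal.ofReal l * ∫⁻ y in Ioi 0, ENNReal.ofReal (1 - p y) := by
    have hm : Measurable fun y => ENNReal.ofReal (1 - Φ.real (Ico 0 (p y))) :=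
      (measurable_const.sub hpΦ).ennreal_ofReal
    have hm' : Measurable fun y => ENNReal.ofReal (1 - p y) :=
      (measurable_const.sub hpmono.measurable).ennreal_ofReal
    rw [← lintegral_const_mul _ hm', ← lintegral_add_left hm, gainPart]
    refine lintegral_congr fun y => ?_
    rw [← ENNReal.ofReal_mul hl, ← ENNReal.ofReal_add (sub_nonneg.2 measureReal_le_one)
      (mul_nonneg hl (sub_nonneg.2 (hp1 y)))]
    congr 1
    rw [weightCdf]
    field_simp
    ring
  have hloss : lossPart Φ l p = (∫⁻ y in Iio 0, ENNReal.ofReal (Φ.real (Ico 0 (p y)))) +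
      ENNReal.ofReal l * ∫⁻ y in Iio 0, ENNReal.ofReal (p y) := by
    rw [← lintegral_const_mul _ (by exact hpmono.measurable.ennreal_ofReal),
      ← lintegral_add_left hpΦ.ennreal_ofReal, lossPart]
    refine lintegral_congr fun y => ?_
    rw [← ENNReal.ofReal_mul hl, ← ENNReal.ofReal_add measureReal_nonneg
      (mul_nonneg hl (hp0 y))]
    congr 1
    rw [weightCdf]
    field_simp
  have hmean : meanWVaR P Φ l R = (l : EReal) *
      (((∫⁻ y in Ioi 0, ENNReal.ofReal (1 - p y) : ENNReal) : EReal) -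
        ((∫⁻ y in Iio 0, ENNReal.ofReal (p y) : ENNReal) : EReal)) -
      -(((∫⁻ y in Ioi 0, ENNReal.ofReal (1 - Φ.real (Ico 0 (p y))) : ENNReal) : EReal) -
        ((∫⁻ y in Iio 0, ENNReal.ofReal (Φ.real (Ico 0 (p y))) : ENNReal) : EReal)) := by
    rw [meanWVaR, wvar, hres, extIntegral_eq P hR, extIntegral_eq Φ hq]
    have hP : ∀ y : ℝ, P {ω | R ω < (y : EReal)} = ENNReal.ofReal (p y) := fun y => by
      rw [← hp, ofReal_measureReal]
    have hΦq : ∀ y : ℝ, Φ {z | quantile P R z < (y : EReal)} =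
        ENNReal.ofReal (Φ.real (Ico 0 (p y))) := fun y => by
      rw [← hp, ← measureReal_quantile_lt hΦ hΦ_one, ofReal_measureReal]
    simp only [measure_le_eq P hR, measure_le_eq Φ hq, measureReal_quantile_lt hΦ hΦ_one, hp, hP,
      hΦq]
  rw [hgain, hloss, hmean]
  exact coe_mul_sub_add_sub hl _ _ _ _

/-! ### The budget as an integral over levels of the log-return -/

theorem logReturn_lt_iff {Ω : Type*} {T x : ℝ} (hT : 0 < T) (hx : 0 < x) (X : Ω → ℝ) (ω : Ω)
    (y : ℝ) : logReturn T x X ω < (y : EReal) ↔ X ω < x * Real.exp (T * y) := by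
  have hT' : 0 < 1 / T := by positivity
  rcases le_or_gt (X ω) 0 with h | h
  · have h1 : X ω / x ≤ 0 := div_nonpos_of_nonpos_of_nonneg h hx.le
    rw [logReturn, ENNReal.ofReal_of_nonpos h1, ENNReal.log_zero, EReal.coe_mul_bot_of_pos hT']
    exact iff_of_true (EReal.bot_lt_coe y) (h.trans_lt (by positivity))
  · have h1 : 0 < X ω / x := div_pos h hx
    rw [logReturn, ENNReal.log_ofReal_of_pos h1, ← EReal.coe_mul, EReal.coe_lt_coe_iff,
      one_div, inv_mul_lt_iff₀ hT, Real.log_lt_iff_lt_exp h1, div_lt_iff₀ hx, mul_comm x]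

theorem measurable_logReturn {Ω : Type*} [MeasurableSpace Ω] {T x : ℝ} {X : Ω → ℝ}
    (hX : Measurable X) (hT : 0 < T) (hx : 0 < x) : Measurable (logReturn T x X) := by
  refine measurable_of_Iio fun v => ?_
  have hreal : ∀ y : ℝ, MeasurableSet (logReturn T x X ⁻¹' Iio (y : EReal)) := fun y => by
    have : logReturn T x X ⁻¹' Iio (y : EReal) = {ω | X ω < x * Real.exp (T * y)} := by
      ext ω; exact logReturn_lt_iff hT hx X ω y
    rw [this]
    exact measurableSet_lt hX measurable_const
  have hunion : logReturn T x X ⁻¹' Iio v =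
      ⋃ q ∈ {q : ℚ | ((q : ℝ) : EReal) < v}, logReturn T x X ⁻¹' Iio ((q : ℝ) : EReal) := by
    ext ω
    simp only [mem_preimage, mem_Iio, mem_iUnion, mem_ofPred_eq, exists_prop]
    constructor
    · intro hω
      obtain ⟨q, h1, h2⟩ := EReal.lt_iff_exists_rat_btwn.1 hω
      exact ⟨q, h2, h1⟩
    · rintro ⟨q, h1, h2⟩
      exact h2.trans h1
  rw [hunion]
  exact MeasurableSet.biUnion (to_countable _) fun q _ => hreal q

/-- `∫ e^{Ty} dy` over the levels `y` with `x e^{Ty} ≤ v` is `v / (x T)`. -/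
theorem lintegral_exp_levels {T x : ℝ} (hT : 0 < T) (hx : 0 < x) (v : ℝ) :
    ∫⁻ y in {y : ℝ | x * Real.exp (T * y) ≤ v}, ENNReal.ofReal (Real.exp (T * y)) =
      ENNReal.ofReal (v / (x * T)) := by
  rcases le_or_gt v 0 with h | h
  · have hempty : {y : ℝ | x * Real.exp (T * y) ≤ v} = ∅ := by
      ext y
      simp only [mem_ofPred_eq, mem_empty_iff_false, iff_false, not_le]
      exact h.trans_lt (by positivity)
    rw [hempty, Measure.restrict_empty, lintegral_zero_measure,
      ENNReal.ofReal_of_nonpos (div_nonpos_of_nonpos_of_nonneg h (by positivity))]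
  · have hset : {y : ℝ | x * Real.exp (T * y) ≤ v} = Iic (Real.log (v / x) / T) := by
      ext y
      rw [mem_ofPred_eq, mem_Iic, le_div_iff₀ hT, Real.le_log_iff_exp_le (div_pos h hx),
        le_div_iff₀ hx, mul_comm x, mul_comm T]
    rw [hset, ← ofReal_integral_eq_lintegral_ofReal (integrableOn_exp_mul_Iic hT _)
      (Filter.Eventually.of_forall fun y => (Real.exp_pos _).le), integral_exp_mul_Iic hT,
      mul_div_cancel₀ _ hT.ne', Real.exp_log (div_pos h hx), div_div]

/-- The budget used by a wealth `X ≥ 0`, as an integral over the levels of its log-return. -/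
theorem lintegral_budget {Ω : Type*} [MeasurableSpace Ω] {P : Measure Ω} [IsProbabilityMeasure P]
    {ξ X : Ω → ℝ} (h : IsRegularDensity P ξ) {T x : ℝ} (hT : 0 < T) (hx : 0 < x)
    (hX : Measurable X) (hX0 : ∀ᵐ ω ∂P, 0 ≤ X ω) (hint : Integrable (fun ω => ξ ω * X ω) P) :
    ∫⁻ y : ℝ, ENNReal.ofReal (Real.exp (T * y) *
      (∫ ω, ξ ω ∂P - ∫ ω in {ω | X ω < x * Real.exp (T * y)}, ξ ω ∂P)) =
      ENNReal.ofReal ((∫ ω, ξ ω * X ω ∂P) / (x * T)) := by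
  set S : Set (ℝ × Ω) := {z | x * Real.exp (T * z.1) ≤ X z.2} with hS
  have hSm : MeasurableSet S := by
    refine measurableSet_le ?_ (hX.comp measurable_snd)
    exact (show Measurable fun z : ℝ × Ω => x * Real.exp (T * z.1) by fun_prop)
  set g : ℝ × Ω → ENNReal := S.indicator
    fun z => ENNReal.ofReal (Real.exp (T * z.1)) * ENNReal.ofReal (ξ z.2) with hg
  have hξm := h.measurable
  have hgm : Measurable g := by
    refine Measurable.indicator ?_ hSm
    fun_prop
  have h1 : ∀ y : ℝ, ENNReal.ofReal (Real.exp (T * y) *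
      (∫ ω, ξ ω ∂P - ∫ ω in {ω | X ω < x * Real.exp (T * y)}, ξ ω ∂P)) = ∫⁻ ω, g (y, ω) ∂P := by
    intro y
    have hm : MeasurableSet {ω | X ω < x * Real.exp (T * y)} :=
      measurableSet_lt hX measurable_const
    have h2 := integral_add_compl hm h.integrable
    have h3 : {ω | X ω < x * Real.exp (T * y)}ᶜ = {ω | (y, ω) ∈ S} := by
      ext ω; simp [hS]
    rw [← h2, add_sub_cancel_left, ENNReal.ofReal_mul (Real.exp_pos _).le,
      ofReal_integral_eq_lintegral_ofReal h.integrable.integrableOn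
        (Filter.Eventually.of_forall fun ω => (h.pos ω).le),
      ← lintegral_const_mul _ h.measurable.ennreal_ofReal, h3,
      ← lintegral_indicator (h3 ▸ hm.compl)]
    rfl
  have h2 : ∀ ω, ∫⁻ y, g (y, ω) = ENNReal.ofReal (ξ ω) * ENNReal.ofReal (X ω / (x * T)) := by
    intro ω
    have hm : MeasurableSet {y : ℝ | x * Real.exp (T * y) ≤ X ω} :=
      measurableSet_le (by fun_prop) measurable_const
    rw [← lintegral_exp_levels hT hx, ← lintegral_const_mul _ (by fun_prop),
      ← lintegral_indicator hm]
    refine lintegral_congr fun y => ?_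
    simp only [hg, hS, indicator, mem_ofPred_eq, mul_comm]
  simp only [h1]
  rw [lintegral_lintegral_swap (f := fun y ω => g (y, ω)) hgm.aemeasurable]
  simp only [h2]
  rw [← integral_div, ofReal_integral_eq_lintegral_ofReal (hint.div_const _)]
  · refine lintegral_congr fun ω => ?_
    rw [← ENNReal.ofReal_mul (h.pos ω).le, mul_div_assoc]
  · filter_upwards [hX0] with ω hω
    exact div_nonneg (mul_nonneg (h.pos ω).le hω) (by positivity)

/-! ### Comparison with the efficient wealth -/

theorem lintegral_le_of_add_le_add {α : Type*} [MeasurableSpace α] {m : Measure α}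
    {u v a b : α → ENNReal} (hv : Measurable v) (ha : Measurable a)
    (hb : Measurable b) (hle : ∀ᵐ y ∂m, u y + a y ≤ v y + b y) (hab : ∫⁻ y, b y ∂m ≤ ∫⁻ y, a y ∂m)
    (hfin : ∫⁻ y, a y ∂m ≠ ⊤) :
    ∫⁻ y, u y ∂m ≤ ∫⁻ y, v y ∂m ∧
    (∫⁻ y, v y ∂m ≤ ∫⁻ y, u y ∂m → ∫⁻ y, u y ∂m ≠ ⊤ → ∀ᵐ y ∂m, u y + a y = v y + b y) := by
  have h1 := lintegral_mono_ae hle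
  rw [lintegral_add_right _ ha, lintegral_add_right _ hb] at h1
  refine ⟨(ENNReal.add_le_add_iff_right hfin).1 (h1.trans (by gcongr)), fun hvu hu => ?_⟩
  refine ae_eq_of_ae_le_of_lintegral_le hle ?_ (hv.add hb).aemeasurable ?_
  · rw [lintegral_add_right _ ha]
    exact ENNReal.add_ne_top.2 ⟨hu, hfin⟩
  · rw [lintegral_add_right _ ha, lintegral_add_right _ hb]
    gcongr

theorem efficientWealth_lt_iff {Ω : Type*} [MeasurableSpace Ω] {P : Measure Ω}
    [IsProbabilityMeasure P] {ξ : Ω → ℝ} (h : IsRegularDensity P ξ) {x : ℝ} (hx : 0 < x)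
    (Φ : Measure ℝ) (l k : ℝ) (ω : Ω) :
    efficientWealth P ξ x Φ l ω < x * k ↔
      deltaRight P ξ Φ l (rankVar P ξ ω) < (∫ ω, ξ ω ∂P) * k := by
  rw [efficientWealth, div_mul_eq_mul_div, div_lt_iff₀ h.integral_pos, mul_assoc,
    mul_lt_mul_iff_right₀ hx, mul_comm k]

/-- The pointwise comparison of the levels of an arbitrary wealth with those of the efficient one:
the multiplier `e^{Ty}` is admissible for all but countably many levels `y`. -/
theorem ae_weightCdf_sub_le {Ω : Type*} [MeasurableSpace Ω] {P : Measure Ω}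
    [IsProbabilityMeasure P] {ξ : Ω → ℝ} (h : IsRegularDensity P ξ) {Φ : Measure ℝ}
    [IsProbabilityMeasure Φ] (hΦ : Φ (Icc 0 1)ᶜ = 0) (hΦ_one : Φ {1} = 0) {l : ℝ} (hl : 0 ≤ l)
    {T x : ℝ} (hT : 0 < T) (hx : 0 < x) {X : Ω → ℝ} (hX : X = efficientWealth P ξ x Φ l) :
    ∀ᵐ y : ℝ, ∀ A : Set Ω, MeasurableSet A →
      weightCdf Φ l (P.real {ω | X ω < x * Real.exp (T * y)}) -
          Real.exp (T * y) * ∫ ω in {ω | X ω < x * Real.exp (T * y)}, ξ ω ∂P ≤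
        weightCdf Φ l (P.real A) - Real.exp (T * y) * ∫ ω in A, ξ ω ∂P ∧
      (weightCdf Φ l (P.real {ω | X ω < x * Real.exp (T * y)}) -
          Real.exp (T * y) * ∫ ω in {ω | X ω < x * Real.exp (T * y)}, ξ ω ∂P =
        weightCdf Φ l (P.real A) - Real.exp (T * y) * ∫ ω in A, ξ ω ∂P →
        A =ᵐ[P] {ω | X ω < x * Real.exp (T * y)}) := by
  have hE := h.integral_pos
  have hZ : Measurable fun ω => deltaRight P ξ Φ l (rankVar P ξ ω) :=
    IsRegularDensity.measurable_deltaRight.comp h.measurable_rankVar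
  have hcount := Measure.countable_meas_level_set_pos (μ := P) hZ
  have hinj : Function.Injective fun y : ℝ => (∫ ω, ξ ω ∂P) * Real.exp (T * y) := by
    intro y y' hyy
    exact mul_left_cancel₀ hT.ne' (Real.exp_injective (mul_left_cancel₀ hE.ne' hyy))
  have hnull := (hcount.preimage hinj).measure_zero (volume : Measure ℝ)
  filter_upwards [compl_mem_ae_iff.2 hnull] with y hy A hA
  have hy0 : P {ω | deltaRight P ξ Φ l (rankVar P ξ ω) = (∫ ω, ξ ω ∂P) * Real.exp (T * y)} = 0 := by
    simpa using hy
  have key := h.weightCdf_sub_le hΦ hΦ_one hl (mul_pos hE (Real.exp_pos _)) hy0 hA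
  rw [mul_div_cancel_left₀ _ hE.ne'] at key
  simp only [hX, efficientWealth_lt_iff h hx]
  exact key

theorem lintegral_ite_pos (f g : ℝ → ENNReal) :
    ∫⁻ y : ℝ, (if 0 < y then f y else g y) = (∫⁻ y in Ioi 0, f y) + ∫⁻ y in Iio 0, g y := by
  rw [← lintegral_add_compl _ (measurableSet_Ioi (a := (0 : ℝ))), compl_Ioi,
    setLIntegral_congr_fun (f := fun y => if 0 < y then f y else g y) (g := f) measurableSet_Ioi
      (fun y hy => if_pos hy),
    setLIntegral_congr_fun (f := fun y => if 0 < y then f y else g y) (g := g) measurableSet_Iic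
      (fun y hy => if_neg (not_lt.2 hy)),
    setLIntegral_congr Iio_ae_eq_Iic]

/-- Random variables `X, Y ≥ 0` coincide when almost all of their lower level sets do. -/
theorem ae_eq_of_ae_level_ae_eq {Ω : Type*} [MeasurableSpace Ω] {P : Measure Ω}
    [IsProbabilityMeasure P] {T x : ℝ} (hT : 0 < T) (hx : 0 < x) {X Y : Ω → ℝ}
    (hX : Measurable X) (hY : Measurable Y) (hX0 : ∀ᵐ ω ∂P, 0 ≤ X ω) (hY0 : ∀ᵐ ω ∂P, 0 ≤ Y ω)
    (h : ∀ᵐ y : ℝ, {ω | Y ω < x * Real.exp (T * y)} =ᵐ[P] {ω | X ω < x * Real.exp (T * y)}) :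
    Y =ᵐ[P] X := by
  have hexp : Measurable fun z : ℝ × Ω => x * Real.exp (T * z.1) := by fun_prop
  have hmeas : MeasurableSet {z : ℝ × Ω |
      Y z.2 < x * Real.exp (T * z.1) ↔ X z.2 < x * Real.exp (T * z.1)} :=
    (measurableSet_lt (hY.comp measurable_snd) hexp).iff
      (measurableSet_lt (hX.comp measurable_snd) hexp)
  have h1 : ∀ᵐ y : ℝ, ∀ᵐ ω ∂P, (Y ω < x * Real.exp (T * y) ↔ X ω < x * Real.exp (T * y)) := by
    filter_upwards [h] with y hy
    filter_upwards [hy] with ω hω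
    exact iff_of_eq hω
  have h2 := (Measure.ae_ae_comm hmeas).1 h1
  -- levels strictly between two distinct values form a nonempty open set
  have key : ∀ a b : ℝ, 0 ≤ a → a < b →
      ¬ ∀ᵐ y : ℝ, (a < x * Real.exp (T * y) ↔ b < x * Real.exp (T * y)) := by
    intro a b ha hab hae
    have hm : 0 < (a + b) / 2 / x := by
      have : 0 < a + b := by linarith
      positivity
    have hopen : IsOpen {y : ℝ | a < x * Real.exp (T * y) ∧ x * Real.exp (T * y) < b} :=
      (isOpen_Ioo (a := a) (b := b)).preimage
        (show Continuous fun y : ℝ => x * Real.exp (T * y) by fun_prop)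
    obtain ⟨y, hy1, hy2⟩ := (Measure.dense_of_ae hae).inter_open_nonempty _ hopen
      ⟨Real.log ((a + b) / 2 / x) / T, by
        rw [mem_ofPred_eq, mul_div_cancel₀ _ hT.ne', Real.exp_log hm, mul_div_cancel₀ _ hx.ne']
        constructor <;> linarith⟩
    exact (lt_asymm hy1.2) (hy2.1 hy1.1)
  filter_upwards [h2, hX0, hY0] with ω h3 h4 h5
  rcases lt_trichotomy (Y ω) (X ω) with hlt | heq | hgt
  · exact absurd h3 (key _ _ h5 hlt)
  · exact heq
  · exact absurd (h3.mono fun y hy => hy.symm) (key _ _ h4 hgt)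

/-- The probability that a wealth `X` stays below the level `x e^{Ty}`, that is, that its log-return
stays below `y`. -/
noncomputable def levelProb {Ω : Type*} [MeasurableSpace Ω] (P : Measure Ω) (T x : ℝ) (X : Ω → ℝ)
    (y : ℝ) : ℝ :=
  P.real {ω | X ω < x * Real.exp (T * y)}

theorem level_subset {Ω : Type*} {T x : ℝ} (hT : 0 < T) (hx : 0 < x) (X : Ω → ℝ) {y y' : ℝ}
    (h : y ≤ y') : {ω | X ω < x * Real.exp (T * y)} ⊆ {ω | X ω < x * Real.exp (T * y')} :=
  fun ω hω => lt_of_lt_of_le (show X ω < _ from hω) (by gcongr)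

theorem monotone_levelProb {Ω : Type*} [MeasurableSpace Ω] (P : Measure Ω) [IsProbabilityMeasure P]
    {T x : ℝ} (hT : 0 < T) (hx : 0 < x) (X : Ω → ℝ) : Monotone (levelProb P T x X) :=
  fun _ _ h => measureReal_mono (level_subset hT hx X h)

theorem integrable_efficientWealth {Ω : Type*} [MeasurableSpace Ω] {P : Measure Ω}
    [IsProbabilityMeasure P] {ξ : Ω → ℝ} (h : IsRegularDensity P ξ) {Φ : Measure ℝ}
    [IsProbabilityMeasure Φ] (hΦ : Φ (Icc 0 1)ᶜ = 0) (hΦ_one : Φ {1} = 0) {l : ℝ} (hl : 0 ≤ l)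
    (x : ℝ) :
    Integrable (fun ω => ξ ω * efficientWealth P ξ x Φ l ω) P ∧
      ∫ ω, ξ ω * efficientWealth P ξ x Φ l ω ∂P = x := by
  obtain ⟨h1, h2⟩ := h.integrable_mul_deltaRight (Φ := Φ) hΦ hΦ_one hl
  have heq : (fun ω => ξ ω * efficientWealth P ξ x Φ l ω) = fun ω =>
      x / (∫ ω', ξ ω' ∂P) * (ξ ω * deltaRight P ξ Φ l (rankVar P ξ ω)) := by
    ext ω
    rw [efficientWealth]
    ring
  rw [heq]
  refine ⟨h1.const_mul _, ?_⟩
  rw [integral_const_mul, h2, div_mul_cancel₀ _ h.integral_pos.ne']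

theorem efficientWealth_nonneg {Ω : Type*} [MeasurableSpace Ω] {P : Measure Ω}
    [IsProbabilityMeasure P] {ξ : Ω → ℝ} (h : IsRegularDensity P ξ) {Φ : Measure ℝ}
    [IsProbabilityMeasure Φ] (hΦ : Φ (Icc 0 1)ᶜ = 0) (hΦ_one : Φ {1} = 0) {l : ℝ} (hl : 0 ≤ l)
    {x : ℝ} (hx : 0 < x) (ω : Ω) : 0 ≤ efficientWealth P ξ x Φ l ω :=
  mul_nonneg (div_pos hx h.integral_pos).le (h.deltaRight_rankVar_nonneg hΦ hΦ_one hl ω)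

theorem exists_measurable_efficientWealth {Ω : Type*} [MeasurableSpace Ω] {P : Measure Ω}
    [IsProbabilityMeasure P] {ξ : Ω → ℝ} (h : IsRegularDensity P ξ) (Φ : Measure ℝ) (l x : ℝ) :
    ∃ g : ℝ → ℝ, Measurable g ∧ efficientWealth P ξ x Φ l = g ∘ ξ := by
  obtain ⟨g, hg, hgξ⟩ := h.exists_measurable_rankVar
  refine ⟨fun y => x / (∫ ω', ξ ω' ∂P) * deltaRight P ξ Φ l (g y),
    measurable_const.mul (IsRegularDensity.measurable_deltaRight.comp hg), ?_⟩
  ext ω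
  rw [efficientWealth, hgξ]
  rfl

/-- Integrated over the levels of the log-return, the pointwise comparison turns into the comparison
of the objectives: the budget terms cancel as the efficient wealth exhausts the endowment. -/
theorem gainPart_add_lossPart_le {Ω : Type*} [MeasurableSpace Ω] {P : Measure Ω}
    [IsProbabilityMeasure P] {ξ : Ω → ℝ} (h : IsRegularDensity P ξ) {Φ : Measure ℝ}
    [IsProbabilityMeasure Φ] (hΦ : Φ (Icc 0 1)ᶜ = 0) (hΦ_one : Φ {1} = 0) {l : ℝ} (hl : 0 ≤ l)
    {T x : ℝ} (hT : 0 < T) (hx : 0 < x) {X Y : Ω → ℝ} (hX : X = efficientWealth P ξ x Φ l)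
    (hY : Measurable Y) (hY0 : ∀ᵐ ω ∂P, 0 ≤ Y ω) (hYint : Integrable (fun ω => ξ ω * Y ω) P)
    (hYx : ∫ ω, ξ ω * Y ω ∂P ≤ x) :
    gainPart Φ l (levelProb P T x Y) + lossPart Φ l (levelProb P T x X) ≤
      gainPart Φ l (levelProb P T x X) + lossPart Φ l (levelProb P T x Y) ∧
    (gainPart Φ l (levelProb P T x X) + lossPart Φ l (levelProb P T x Y) ≤
        gainPart Φ l (levelProb P T x Y) + lossPart Φ l (levelProb P T x X) →
      gainPart Φ l (levelProb P T x Y) + lossPart Φ l (levelProb P T x X) ≠ ⊤ → Y =ᵐ[P] X) := by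
  have hXm : Measurable X := by
    obtain ⟨g, hg, hgξ⟩ := exists_measurable_efficientWealth h Φ l x
    rw [hX, hgξ]
    exact hg.comp h.measurable
  have hX0 : ∀ᵐ ω ∂P, 0 ≤ X ω :=
    Filter.Eventually.of_forall fun ω => hX ▸ efficientWealth_nonneg h hΦ hΦ_one hl hx ω
  obtain ⟨hXint, hXx⟩ := integrable_efficientWealth h (Φ := Φ) hΦ hΦ_one hl x
  rw [← hX] at hXint hXx
  set E := ∫ ω, ξ ω ∂P with hE
  set q : (Ω → ℝ) → ℝ → ℝ := fun Z y => ∫ ω in {ω | Z ω < x * Real.exp (T * y)}, ξ ω ∂P with hq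
  set b : (Ω → ℝ) → ℝ → ENNReal := fun Z y =>
    ENNReal.ofReal ((1 + l) * (Real.exp (T * y) * (E - q Z y))) with hb
  set gain : (Ω → ℝ) → ℝ → ENNReal := fun Z y =>
    ENNReal.ofReal ((1 + l) * (1 - weightCdf Φ l (levelProb P T x Z y))) with hgain
  set loss : (Ω → ℝ) → ℝ → ENNReal := fun Z y =>
    ENNReal.ofReal ((1 + l) * weightCdf Φ l (levelProb P T x Z y)) with hloss
  have h1l : 0 < 1 + l := by linarith
  have hξ0 : 0 ≤ᵐ[P] ξ := Filter.Eventually.of_forall fun ω => (h.pos ω).le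
  have hqE : ∀ Z y, 0 ≤ E - q Z y := fun Z y => sub_nonneg.2 (setIntegral_le_integral h.integrable hξ0)
  have hqmono : ∀ Z, Monotone (q Z) := fun Z y y' hy =>
    setIntegral_mono_set h.integrable.integrableOn (ae_restrict_of_ae hξ0)
      (level_subset hT hx Z hy).eventuallyLE
  have hψmono : ∀ Z : Ω → ℝ, Monotone fun y => weightCdf Φ l (levelProb P T x Z y) := fun Z =>
    (monotone_weightCdf Φ hl).comp (monotone_levelProb P hT hx Z)
  have hψ0 : ∀ (Z : Ω → ℝ) y, 0 ≤ weightCdf Φ l (levelProb P T x Z y) := fun Z y =>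
    weightCdf_nonneg Φ hl measureReal_nonneg
  have hψ1 : ∀ (Z : Ω → ℝ) y, 0 ≤ 1 - weightCdf Φ l (levelProb P T x Z y) := fun Z y =>
    sub_nonneg.2 (weightCdf_le_one Φ hl measureReal_le_one)
  have hbm : ∀ Z, Measurable (b Z) := fun Z => by
    have hqm := (hqmono Z).measurable
    exact Measurable.ennreal_ofReal (by fun_prop)
  have hgm : ∀ Z, Measurable (gain Z) := fun Z => by
    have hqm := (hψmono Z).measurable
    exact Measurable.ennreal_ofReal (by fun_prop)
  have hlm : ∀ Z, Measurable (loss Z) := fun Z => by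
    have hqm := (hψmono Z).measurable
    exact Measurable.ennreal_ofReal (by fun_prop)
  have hbint : ∀ Z, Measurable Z → (∀ᵐ ω ∂P, 0 ≤ Z ω) → Integrable (fun ω => ξ ω * Z ω) P →
      ∫⁻ y, b Z y = ENNReal.ofReal (1 + l) * ENNReal.ofReal ((∫ ω, ξ ω * Z ω ∂P) / (x * T)) := by
    intro Z hZ hZ0 hZint
    rw [← lintegral_budget h hT hx hZ hZ0 hZint, ← lintegral_const_mul' _ _ ENNReal.ofReal_ne_top]
    exact lintegral_congr fun y => ENNReal.ofReal_mul h1l.le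
  have hcmp := ae_weightCdf_sub_le h hΦ hΦ_one hl hT hx hX
  have hYA : ∀ y : ℝ, MeasurableSet {ω | Y ω < x * Real.exp (T * y)} := fun y =>
    measurableSet_lt hY measurable_const
  have hk : ∀ y : ℝ, 0 < Real.exp (T * y) := fun y => Real.exp_pos _
  have hadd : ∀ {s t : ℝ}, 0 ≤ s → 0 ≤ t → ENNReal.ofReal ((1 + l) * s) +
      ENNReal.ofReal ((1 + l) * t) = ENNReal.ofReal ((1 + l) * (s + t)) := fun hs ht => by
    rw [mul_add, ENNReal.ofReal_add (mul_nonneg h1l.le hs) (mul_nonneg h1l.le ht)]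
  have hmain := lintegral_le_of_add_le_add (m := volume)
    (u := fun y => if 0 < y then gain Y y else loss X y)
    (v := fun y => if 0 < y then gain X y else loss Y y) (a := b X) (b := b Y)
    (Measurable.ite measurableSet_Ioi (hgm X) (hlm Y)) (hbm X) (hbm Y) (by
      filter_upwards [hcmp] with y hy
      have hle : weightCdf Φ l (levelProb P T x X y) - Real.exp (T * y) * q X y ≤
        weightCdf Φ l (levelProb P T x Y y) - Real.exp (T * y) * q Y y := (hy _ (hYA y)).1
      have hbX := mul_nonneg (hk y).le (hqE X y)
      have hbY := mul_nonneg (hk y).le (hqE Y y)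
      simp only [hgain, hloss, hb]
      split_ifs
      · rw [hadd (hψ1 Y y) hbX, hadd (hψ1 X y) hbY]
        refine ENNReal.ofReal_le_ofReal (mul_le_mul_of_nonneg_left (by linarith) h1l.le)
      · rw [hadd (hψ0 X y) hbX, hadd (hψ0 Y y) hbY]
        refine ENNReal.ofReal_le_ofReal (mul_le_mul_of_nonneg_left (by linarith) h1l.le))
    (by
      rw [hbint Y hY hY0 hYint, hbint X hXm hX0 hXint, hXx]
      gcongr)
    (by
      rw [hbint X hXm hX0 hXint]
      exact ENNReal.mul_ne_top ENNReal.ofReal_ne_top ENNReal.ofReal_ne_top)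
  rw [lintegral_ite_pos, lintegral_ite_pos] at hmain
  refine ⟨hmain.1, fun hrev hfin => ae_eq_of_ae_level_ae_eq hT hx hXm hY hX0 hY0 ?_⟩
  filter_upwards [hcmp, hmain.2 hrev hfin] with y hy heq
  refine (hy _ (hYA y)).2 ?_
  change weightCdf Φ l (levelProb P T x X y) - Real.exp (T * y) * q X y =
    weightCdf Φ l (levelProb P T x Y y) - Real.exp (T * y) * q Y y
  have hbX := mul_nonneg (hk y).le (hqE X y)
  have hbY := mul_nonneg (hk y).le (hqE Y y)
  simp only [hgain, hloss, hb] at heq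
  split_ifs at heq
  · rw [hadd (hψ1 Y y) hbX, hadd (hψ1 X y) hbY, ENNReal.ofReal_eq_ofReal_iff
      (mul_nonneg h1l.le (add_nonneg (hψ1 Y y) hbX))
      (mul_nonneg h1l.le (add_nonneg (hψ1 X y) hbY))] at heq
    linarith [mul_left_cancel₀ h1l.ne' heq]
  · rw [hadd (hψ0 X y) hbX, hadd (hψ0 Y y) hbY, ENNReal.ofReal_eq_ofReal_iff
      (mul_nonneg h1l.le (add_nonneg (hψ0 X y) hbX))
      (mul_nonneg h1l.le (add_nonneg (hψ0 Y y) hbY))] at heq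
    linarith [mul_left_cancel₀ h1l.ne' heq]

/-- The efficient wealth has a finite loss part, by comparison with the empty event: its weighted
probability of a log-return below `y` is at most `e^{Ty} E[ξ]`. -/
theorem lossPart_efficientWealth_ne_top {Ω : Type*} [MeasurableSpace Ω] {P : Measure Ω}
    [IsProbabilityMeasure P] {ξ : Ω → ℝ} (h : IsRegularDensity P ξ) {Φ : Measure ℝ}
    [IsProbabilityMeasure Φ] (hΦ : Φ (Icc 0 1)ᶜ = 0) (hΦ_one : Φ {1} = 0) {l : ℝ} (hl : 0 ≤ l)
    {T x : ℝ} (hT : 0 < T) (hx : 0 < x) :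
    lossPart Φ l (levelProb P T x (efficientWealth P ξ x Φ l)) ≠ ⊤ := by
  have hint : IntegrableOn (fun y => (1 + l) * ((∫ ω, ξ ω ∂P) * Real.exp (T * y))) (Iio (0 : ℝ)) :=
    (((integrableOn_exp_mul_Iic hT 0).mono_set Iio_subset_Iic_self).const_mul _).const_mul _
  refine ne_top_of_le_ne_top hint.lintegral_lt_top.ne ?_
  refine lintegral_mono_ae (ae_restrict_of_ae ?_)
  filter_upwards [ae_weightCdf_sub_le h hΦ hΦ_one hl hT hx rfl] with y hy
  have h1 := (hy ∅ MeasurableSet.empty).1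
  simp only [measureReal_empty, weightCdf_zero, Measure.restrict_empty, integral_zero_measure,
    mul_zero, sub_zero] at h1
  have h2 : ∫ ω in {ω | efficientWealth P ξ x Φ l ω < x * Real.exp (T * y)}, ξ ω ∂P ≤
      ∫ ω, ξ ω ∂P :=
    setIntegral_le_integral h.integrable (Filter.Eventually.of_forall fun ω => (h.pos ω).le)
  refine ENNReal.ofReal_le_ofReal (mul_le_mul_of_nonneg_left ?_ (by linarith))
  have h3 := mul_le_mul_of_nonneg_right h2 (Real.exp_pos (T * y)).le
  rw [levelProb]
  linarith

/-- Optimality and uniqueness of the efficient wealth among all measurable wealths within budget. -/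
theorem meanWVaR_le_efficientWealth {Ω : Type*} [MeasurableSpace Ω] {P : Measure Ω}
    [IsProbabilityMeasure P] {ξ : Ω → ℝ} (h : IsRegularDensity P ξ) {Φ : Measure ℝ}
    [IsProbabilityMeasure Φ] (hΦ : Φ (Icc 0 1)ᶜ = 0) (hΦ_one : Φ {1} = 0) {l : ℝ} (hl : 0 ≤ l)
    {T x : ℝ} (hT : 0 < T) (hx : 0 < x) {Y : Ω → ℝ} (hY : Measurable Y)
    (hY0 : ∀ᵐ ω ∂P, 0 ≤ Y ω) (hYint : Integrable (fun ω => ξ ω * Y ω) P)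
    (hYx : ∫ ω, ξ ω * Y ω ∂P ≤ x) :
    meanWVaR P Φ l (logReturn T x Y) ≤
      meanWVaR P Φ l (logReturn T x (efficientWealth P ξ x Φ l)) ∧
    (meanWVaR P Φ l (logReturn T x (efficientWealth P ξ x Φ l)) ≤
        meanWVaR P Φ l (logReturn T x Y) →
      meanWVaR P Φ l (logReturn T x Y) ≠ ⊤ → Y =ᵐ[P] efficientWealth P ξ x Φ l) := by
  have hXm : Measurable (efficientWealth P ξ x Φ l) := by
    obtain ⟨g, hg, hgξ⟩ := exists_measurable_efficientWealth h Φ l x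
    rw [hgξ]
    exact hg.comp h.measurable
  have hlevel : ∀ (Z : Ω → ℝ) (y : ℝ),
      P.real {ω | logReturn T x Z ω < (y : EReal)} = levelProb P T x Z y := fun Z y => by
    simp only [logReturn_lt_iff hT hx, levelProb]
  obtain ⟨hYval, hYbot⟩ := meanWVaR_eq hΦ hΦ_one hl (measurable_logReturn hY hT hx) (hlevel Y)
  have hXloss := lossPart_efficientWealth_ne_top h hΦ hΦ_one hl hT hx (Φ := Φ)
  have hXval := (meanWVaR_eq hΦ hΦ_one hl (measurable_logReturn hXm hT hx) (hlevel _)).1 hXloss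
  obtain ⟨hle, heq⟩ := gainPart_add_lossPart_le h hΦ hΦ_one hl hT hx rfl hY hY0 hYint hYx
  have hXne : meanWVaR P Φ l (logReturn T x (efficientWealth P ξ x Φ l)) ≠ ⊥ := by
    rw [hXval]
    refine ne_bot_of_le_ne_bot (b := (0 : EReal) - lossPart Φ l
      (levelProb P T x (efficientWealth P ξ x Φ l))) ?_
      (EReal.sub_le_sub (EReal.coe_ennreal_nonneg _) le_rfl)
    rw [zero_sub, ne_eq, EReal.neg_eq_bot_iff]
    simpa using hXloss
  by_cases hYloss : lossPart Φ l (levelProb P T x Y) = ⊤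
  · rw [hYbot hYloss]
    exact ⟨bot_le, fun hcon => absurd (le_bot_iff.1 hcon) hXne⟩
  · have hYv := hYval hYloss
    rw [hYv, hXval]
    refine ⟨sub_le_sub_of_add_le_add hYloss hXloss hle, fun hrev hfin => ?_⟩
    have hYgain : gainPart Φ l (levelProb P T x Y) ≠ ⊤ := fun htop => by
      lift lossPart Φ l (levelProb P T x Y) to NNReal using hYloss with b
      rw [htop, EReal.coe_ennreal_top] at hfin
      exact hfin (EReal.top_sub_coe (b : ℝ))
    exact heq (add_le_add_of_sub_le_sub hXloss hYgain hYloss hrev)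
      (ENNReal.add_ne_top.2 ⟨hYgain, hXloss⟩)

/-! ### The lognormal state price density -/

theorem isRegularDensity_stateDensity {Ω : Type*} [MeasurableSpace Ω] {P : Measure Ω}
    [IsProbabilityMeasure P] {T : ℝ} (hT : 0 < T) {W : ℝ → Ω → ℝ} (hW : IsBrownianMotionOn P T W)
    {r μ σ : ℝ} (hσ : 0 < σ) (hμr : μ ≠ r) : IsRegularDensity P (stateDensity r μ σ W T) := by
  have hWm : Measurable (W T) := hW.measurable T ⟨hT.le, le_rfl⟩
  set θ := (μ - r) / σ with hθdef
  have hθ : θ ≠ 0 := div_ne_zero (sub_ne_zero.2 hμr) hσ.ne'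
  have hv : T.toNNReal ≠ 0 := by simpa using hT
  have hlaw : P.map (W T) = gaussianReal 0 T.toNNReal := by
    have h1 := hW.gaussian 0 T le_rfl hT.le le_rfl
    rw [sub_zero] at h1
    rw [← h1]
    refine Measure.map_congr ?_
    filter_upwards [hW.start] with ω hω
    rw [hω, sub_zero]
  set g : ℝ → ℝ := fun w => Real.exp (-(r + θ ^ 2 / 2) * T - θ * w) with hg
  have hξ : stateDensity r μ σ W T = fun ω => g (W T ω) := rfl
  have hgm : Measurable g := by fun_prop
  rw [hξ]
  have hmap : ∀ {S : Set ℝ}, MeasurableSet S → P {ω | g (W T ω) ∈ S} =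
      gaussianReal 0 T.toNNReal (g ⁻¹' S) := fun hS => by
    rw [← hlaw, Measure.map_apply hWm (hgm hS)]
    rfl
  have := nullSingletonClass_gaussianReal (μ := 0) hv
  refine ⟨hgm.comp hWm, fun ω => Real.exp_pos _, ?_, fun a => ?_, fun a b ha hab => ?_⟩
  · have h1 : Integrable g (P.map (W T)) := by
      rw [hlaw]
      refine ((integrable_exp_mul_gaussianReal (-θ)).const_mul
        (Real.exp (-(r + θ ^ 2 / 2) * T))).congr (Filter.Eventually.of_forall fun w => ?_)
      simp only [hg]
      rw [← Real.exp_add]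
      congr 1
      ring
    exact h1.comp_measurable hWm
  · have h1 := hmap (measurableSet_singleton a)
    refine h1.trans (Set.Subsingleton.measure_zero ?_ _)
    intro w hw w' hw'
    have h2 : g w = g w' := (show g w = a from hw).trans (show g w' = a from hw').symm
    have h3 := Real.exp_injective h2
    exact mul_left_cancel₀ hθ (by linarith)
  · rw [hmap measurableSet_Ioo, pos_iff_ne_zero]
    intro h0
    have h1 := gaussianReal_absolutelyContinuous' 0 hv h0
    have hgc : Continuous g := by fun_prop
    refine ((isOpen_Ioo.preimage hgc).measure_pos volume ?_).ne' h1
    have hpos : 0 < (a + b) / 2 := by linarith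
    refine ⟨(-(r + θ ^ 2 / 2) * T - Real.log ((a + b) / 2)) / θ, ?_⟩
    rw [mem_preimage, hg]
    simp only
    rw [mul_div_cancel₀ _ hθ, sub_sub_cancel, Real.exp_log hpos]
    constructor <;> linarith

theorem measurable_of_augmentedSigma {Ω : Type*} [MeasurableSpace Ω] {P : Measure Ω}
    [P.IsComplete] {T : ℝ} {W : ℝ → Ω → ℝ} (hW : ∀ t ∈ Icc 0 T, Measurable (W t)) {X : Ω → ℝ}
    (hX : Measurable[augmentedSigma P W T] X) : Measurable X := by
  intro S hS
  obtain ⟨A, hA, hAS⟩ := hX hS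
  have hle : (⨆ s ∈ Icc 0 T, MeasurableSpace.comap (W s) (inferInstance : MeasurableSpace ℝ)) ≤
      ‹MeasurableSpace Ω› := iSup₂_le fun s hs => (hW s hs).comap_le
  exact (NullMeasurableSet.congr (hle A hA).nullMeasurableSet hAS.symm).measurable_of_complete

theorem measurable_augmentedSigma_stateDensity {Ω : Type*} [MeasurableSpace Ω] (P : Measure Ω)
    {T : ℝ} (hT : 0 < T) (W : ℝ → Ω → ℝ) (r μ σ : ℝ) :
    Measurable[augmentedSigma P W T] (stateDensity r μ σ W T) := by
  have hle : MeasurableSpace.comap (W T) (inferInstance : MeasurableSpace ℝ) ≤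
      augmentedSigma P W T :=
    (le_iSup₂_of_le (f := fun s (_ : s ∈ Icc 0 T) =>
      MeasurableSpace.comap (W s) (inferInstance : MeasurableSpace ℝ)) T ⟨hT.le, le_rfl⟩
      le_rfl).trans le_eventuallyMeasurableSpace
  have hWT : Measurable[augmentedSigma P W T] (W T) :=
    (comap_measurable (W T)).mono hle le_rfl
  have hg : Measurable fun w : ℝ =>
      Real.exp (-(r + ((μ - r) / σ) ^ 2 / 2) * T - ((μ - r) / σ) * w) := by fun_prop
  exact hg.comp hWT

/-! ### The efficient portfolio in the Brownian market -/

theorem logReturn_efficientWealth {Ω : Type*} [MeasurableSpace Ω] (P : Measure Ω) (ξ : Ω → ℝ)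
    (T : ℝ) {x : ℝ} (hx : 0 < x) (Φ : Measure ℝ) (l : ℝ) (ω : Ω) :
    logReturn T x (efficientWealth P ξ x Φ l) ω = ((1 / T : ℝ) : EReal) *
      ENNReal.log (ENNReal.ofReal (deltaRight P ξ Φ l (rankVar P ξ ω) / ∫ ω', ξ ω' ∂P)) := by
  rw [logReturn, efficientWealth]
  congr 3
  rw [div_mul_eq_mul_div, div_right_comm, mul_div_cancel_left₀ _ hx.ne']

theorem meanWVaR_zero {Ω : Type*} [MeasurableSpace Ω] (P : Measure Ω) (Φ : Measure ℝ)
    (R : Ω → EReal) : meanWVaR P Φ 0 R = -wvar P Φ R := by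
  rw [meanWVaR, EReal.coe_zero, zero_mul, zero_sub]

end MeanWVaR

theorem proposition3p3 {Ω : Type*} [MeasurableSpace Ω] (P : Measure Ω) [IsProbabilityMeasure P]
    [P.IsComplete] (T : ℝ) (hT : 0 < T) (W : ℝ → Ω → ℝ)
    (hW : MeanWVaR.IsBrownianMotionOn P T W)
    (r μ σ : ℝ) (hr : 0 < r) (hμ : 0 < μ) (hσ : 0 < σ) (hμr : μ ≠ r)
    (x : ℝ) (hx : 0 < x)
    (Φ : Measure ℝ) [IsProbabilityMeasure Φ] (hΦ : Φ (Set.Icc 0 1)ᶜ = 0)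
    (hΦ_one : Φ {1} = 0) (hΦ_unif : Φ ≠ volume.restrict (Set.Icc 0 1))
    (ξ : Ω → ℝ) (hξ : ξ = MeanWVaR.stateDensity r μ σ W T) :
    (∀ l : ℝ, 0 ≤ l →
      -- the efficient wealth is optimal
      MeanWVaR.IsMeanWVaROptimal (MeanWVaR.augmentedSigma P W T) P ξ T x Φ l (MeanWVaR.efficientWealth P ξ x Φ l) ∧
      -- it is the only optimal solution, provided the optimal value is finite
      (∀ X : Ω → ℝ, MeanWVaR.IsMeanWVaROptimal (MeanWVaR.augmentedSigma P W T) P ξ T x Φ l X →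
        MeanWVaR.meanWVaR P Φ l (MeanWVaR.logReturn T x X) ≠ ⊤ →
        X =ᵐ[P] MeanWVaR.efficientWealth P ξ x Φ l) ∧
      -- its log-return
      (∀ ω, MeanWVaR.logReturn T x (MeanWVaR.efficientWealth P ξ x Φ l) ω =
        ((1 / T : ℝ) : EReal) * ENNReal.log (ENNReal.ofReal
          (MeanWVaR.deltaRight P ξ Φ l (MeanWVaR.rankVar P ξ ω) / ∫ ω', ξ ω' ∂P)))) ∧
    -- the min-risk portfolio
    MeanWVaR.IsMinRiskOptimal (MeanWVaR.augmentedSigma P W T) P ξ T x Φ (MeanWVaR.efficientWealth P ξ x Φ 0) ∧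
    (∀ X : Ω → ℝ, MeanWVaR.IsMinRiskOptimal (MeanWVaR.augmentedSigma P W T) P ξ T x Φ X →
      MeanWVaR.wvar P Φ (MeanWVaR.logReturn T x X) ≠ ⊥ →
      X =ᵐ[P] MeanWVaR.efficientWealth P ξ x Φ 0) ∧
    (∀ ω, MeanWVaR.logReturn T x (MeanWVaR.efficientWealth P ξ x Φ 0) ω =
      ((1 / T : ℝ) : EReal) * ENNReal.log (ENNReal.ofReal
        (MeanWVaR.deltaRight P ξ Φ 0 (MeanWVaR.rankVar P ξ ω) / ∫ ω', ξ ω' ∂P))) := by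
  subst hξ
  have hreg := MeanWVaR.isRegularDensity_stateDensity hT hW (r := r) hσ hμr
  have hfeas : ∀ l : ℝ, 0 ≤ l → MeanWVaR.IsFeasible (MeanWVaR.augmentedSigma P W T) P
      (MeanWVaR.stateDensity r μ σ W T) x
      (MeanWVaR.efficientWealth P (MeanWVaR.stateDensity r μ σ W T) x Φ l) := by
    intro l hl
    obtain ⟨g, hg, hgξ⟩ := MeanWVaR.exists_measurable_efficientWealth hreg Φ l x
    obtain ⟨hint, hbudget⟩ := MeanWVaR.integrable_efficientWealth hreg (Φ := Φ) hΦ hΦ_one hl x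
    refine ⟨?_, Filter.Eventually.of_forall
      (MeanWVaR.efficientWealth_nonneg hreg hΦ hΦ_one hl hx), hint, hbudget.le⟩
    rw [hgξ]
    exact hg.comp (MeanWVaR.measurable_augmentedSigma_stateDensity P hT W r μ σ)
  have hcmp := fun (l : ℝ) (hl : 0 ≤ l) (Y : Ω → ℝ) (hY : MeanWVaR.IsFeasible
      (MeanWVaR.augmentedSigma P W T) P (MeanWVaR.stateDensity r μ σ W T) x Y) =>
    MeanWVaR.meanWVaR_le_efficientWealth hreg hΦ hΦ_one hl hT hx
      (MeanWVaR.measurable_of_augmentedSigma hW.measurable hY.measurable) hY.nonneg hY.integrable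
      hY.budget
  refine ⟨fun l hl => ⟨⟨hfeas l hl, fun Y hY => (hcmp l hl Y hY).1⟩,
    fun X hX hfin => (hcmp l hl X hX.1).2 (hX.2 _ (hfeas l hl)) hfin,
    MeanWVaR.logReturn_efficientWealth P _ T hx Φ l⟩,
    ⟨hfeas 0 le_rfl, fun Y hY => ?_⟩, fun X hX hfin => ?_,
    MeanWVaR.logReturn_efficientWealth P _ T hx Φ 0⟩
  · have h := (hcmp 0 le_rfl Y hY).1
    rwa [MeanWVaR.meanWVaR_zero, MeanWVaR.meanWVaR_zero, EReal.neg_le_neg_iff] at h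
  · refine (hcmp 0 le_rfl X hX.1).2 ?_ ?_
    · rw [MeanWVaR.meanWVaR_zero, MeanWVaR.meanWVaR_zero, EReal.neg_le_neg_iff]
      exact hX.2 _ (hfeas 0 le_rfl)
    · rw [MeanWVaR.meanWVaR_zero, ne_eq, EReal.neg_eq_top_iff]
      exact hfin
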